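/- Let $\mathbb{T}^2=\mathbb{R}^2/\mathbb{Z}^2$, let $V\in C^\infty(\mathbb{T}^2,\mathbb{R})$, and let $\hbar\to0^+$ run through $(0,1]$ or through a subset $H\subset(0,1]$ (for instance a sequence). Let $0<\varepsilon_\hbar\le1$, and let $(\psi_\hbar)$ be normalized in $L^2(\mathbb{T}^2)$ and such that $$\lim_{R\to+\infty}\limsup_{\hbar\to0^+}\left\|\mathbf 1_{[R,+\infty[}(-\hbar^2\Delta)\psi_\hbar\right\|_{L^2(\mathbb{T}^2)}=0 .$$ Suppose that $(\psi_\hbar)$ generates a unique semiclassical measure $F_0$, i.e. $F_0$ is a finite measure on $T^*\mathbb{T}^2=\mathbb{T}^2\times\mathbb{R}^2$ such that for every $a\in C^\infty_c(T^*\mathbb{T}^2)$ $$\lim_{\hbar\to0^+}\langle\psi_\hbar,\operatorname{Op}_\hbar(a)\psi_\hbar\rangle_{L^2(\mathbb{T}^2)}=\int_{T^*\mathbb{T}^2}a\,dF_0 ,$$ where $\operatorname{Op}_\hbar(a)u(x)=\frac{1}{(2\pi\hbar)^2}\iint_{\mathbb{R}^4}e^{\frac i\hbar\langle x-y,\xi\rangle}a(x,\xi)u(y)\,dy\,d\xi$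 is the standard quantization (acting on $\mathbb{Z}^2$-periodic functions $u$; the integral in $\xi$ is taken first). Let $u_\hbar$ and $u^\varepsilon_\hbar$ be the solutions of $$i\hbar\partial_tu_\hbar=-\frac{\hbar^2}{2}\Delta u_\hbar,\qquad i\hbar\partial_tu^\varepsilon_\hbar=-\frac{\hbar^2}{2}\Delta u^\varepsilon_\hbar+\varepsilon_\hbar Vu^\varepsilon_\hbar,\qquad u_\hbar(0)=u^\varepsilon_\hbar(0)=\psi_\hbar ,$$ and put $\tau_\hbar^c=\hbar/\varepsilon_\hbar$ and $\varphi^s(x,\xi)=(x+s\xi,\xi)$. Then: 1. if $\varepsilon_\hbar=\hbar$, then for every $t\in\mathbb{R}$ $$\lim_{\hbar\to0^+}\left|\langle u^\varepsilon_\hbar(t\tau^c_\hbar),u_\hbar(t\tau^c_\hbar)\rangle_{L^2(\mathbb{T}^2)}\right|^2=\left|\int_{T^*\mathbb{T}^2}e^{i\int_0^tV\circ\varphi^s\,ds}\,dF_0\right|^2;$$ 2. if $\hbar\ll\varepsilon_\hbar$, i.e. $\hbar/\varepsilon_\hbar\to0$ as $\hbar\to0^+$, then for every $t\in\mathbb{R}$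 $$\lim_{\hbar\to0^+}\left|\langle u^\varepsilon_\hbar(t\tau^c_\hbar),u_\hbar(t\tau^c_\hbar)\rangle_{L^2(\mathbb{T}^2)}\right|^2=\left|\int_{T^*\mathbb{T}^2}e^{itV(x)}\,F_0(dx,d\xi)\right|^2.$$ -/

import Mathlib

open MeasureTheory Filter Topology Complex
open scoped ContDiff InnerProductSpace Laplacian

namespace Loschmidt

/-- The plane `ℝ²` with its Euclidean structure. -/
abbrev Plane : Type := EuclideanSpace ℝ (Fin 2)

/-- The standard torus `𝕋² = ℝ²/ℤ²`. -/
abbrev Torus : Type := UnitAddTorus (Fin 2)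

/-- Lebesgue measure on `𝕋²`: the product of the two Haar measures of total mass one. -/
noncomputable abbrev torusMeasure : Measure Torus := Measure.pi fun _ => AddCircle.haarAddCircle

/-- The cotangent bundle `T*𝕋² = 𝕋² × ℝ²`. -/
abbrev Phase : Type := Torus × Plane

/-- The Hilbert space `L²(𝕋²)`. -/
abbrev L2 : Type := Lp ℂ 2 torusMeasure

/-- The covering map `ℝ² → 𝕋²`. -/
def toTorus (x : Plane) : Torus := fun i => ((x i : ℝ) : UnitAddCircle)

/-- Smooth functions on the torus: those whose `ℤ²`-periodic lift to `ℝ²` is smooth. -/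
def TorusSmooth {F : Type*} [NormedAddCommGroup F] [NormedSpace ℝ F] (f : Torus → F) : Prop :=
  ContDiff ℝ ∞ (fun x : Plane => f (toTorus x))

/-- The Laplacian of a function on the flat torus, computed in the chart `y ↦ x + y` at `x`. -/
noncomputable def torusLaplacian (f : Torus → ℂ) (x : Torus) : ℂ :=
  Δ (fun y : Plane => f (x + toTorus y)) 0

/-- `C_c^∞(T*𝕋²)`: compactly supported functions on the cotangent bundle with smooth lift. -/
structure IsTestSymbol (a : Phase → ℂ) : Prop where
  smooth : ContDiff ℝ ∞ (fun p : Plane × Plane => a (toTorus p.1, p.2))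
  compactSupport : HasCompactSupport a

/-- `u` is the solution, in the sense of distributions and continuous in time with values in
`L²(𝕋²)`, of `i h ∂ₜ u = - (h² / 2) Δ u + W u` with `u(0) = ψ`. -/
structure IsSchrodingerSolution (h : ℝ) (W : Torus → ℝ) (ψ : L2) (u : ℝ → L2) : Prop where
  continuous : Continuous u
  initial : u 0 = ψ
  equation : ∀ φ : Torus → ℂ, TorusSmooth φ → ∀ t : ℝ,
    HasDerivAt (fun s : ℝ => I * h * ∫ x, φ x * u s x ∂torusMeasure)
      (∫ x, (-(h ^ 2 / 2 : ℝ) * torusLaplacian φ x + W x * φ x) * u t x ∂torusMeasure) t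

/-- The kernel of the standard quantization:
`K(x, z) = (2 π h)⁻² ∫ exp (i ⟨z, ξ⟩ / h) a(x, ξ) dξ`. -/
noncomputable def quantKernel (h : ℝ) (a : Phase → ℂ) (x : Torus) (z : Plane) : ℂ :=
  ((2 * Real.pi * h : ℝ) : ℂ)⁻¹ ^ 2 * ∫ ξ : Plane, exp (I * (⟪z, ξ⟫_ℝ / h : ℝ)) * a (x, ξ)

/-- The standard quantization `Op_h(a) u (x) = (2 π h)⁻² ∬ exp (i ⟨x - y, ξ⟩ / h) a(x, ξ) u(y) dy dξ`
(integrals over `ℝ²`) of a compactly supported symbol, acting on a function `u` on the torus, that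
is, on a `ℤ²`-periodic function; the variable of integration is `z = x - y`. -/
noncomputable def quantization (h : ℝ) (a : Phase → ℂ) (u : Torus → ℂ) (x : Torus) : ℂ :=
  ∫ z : Plane, quantKernel h a x z * u (x - toTorus z)

/-- The Wigner distribution `a ↦ ⟨ψ, Op_h(a) ψ⟩_{L²(𝕋²)}` (conjugate-linear on the left). -/
noncomputable def wigner (h : ℝ) (ψ : L2) (a : Phase → ℂ) : ℂ :=
  ∫ x, starRingEnd ℂ (ψ x) * quantization h a ψ x ∂torusMeasure

/-- The finite measure `F₀` on `T*𝕋²` is the (unique) semiclassical measure of the family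
`(ψ_h)`, the semiclassical parameter `h → 0` running through the set `H`. -/
def IsSemiclassicalMeasure (H : Set ℝ) (ψ : ℝ → L2) (F₀ : Measure Phase) : Prop :=
  IsFiniteMeasure F₀ ∧ ∀ a : Phase → ℂ, IsTestSymbol a →
    Tendsto (fun h => wigner h (ψ h) a) (𝓝[H] 0) (𝓝 (∫ p, a p ∂F₀))

open Classical in
/-- The spectral projector `1_J(-h² Δ)` on `L²(𝕋²)`, through the orthonormal basis of
eigenfunctions `e_k(x) = exp (2 i π k · x)`, `-h² Δ e_k = 4 π² h² |k|² e_k`, `k ∈ ℤ²`. -/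
noncomputable def spectralProj (h : ℝ) (J : Set ℝ) (ψ : L2) : L2 :=
  ∑' k : Fin 2 → ℤ,
    if 4 * Real.pi ^ 2 * h ^ 2 * ∑ i, (k i : ℝ) ^ 2 ∈ J
    then UnitAddTorus.mFourierCoeff ψ k •
      ContinuousMap.toLp 2 torusMeasure ℂ (UnitAddTorus.mFourier k) else 0

/-- No mass escapes to infinite frequency at the scale `h⁻¹`:
`lim_{R → ∞} limsup_{h → 0} ‖1_{[R, ∞)}(-h² Δ) ψ_h‖ = 0`. -/
def IsOscillating (H : Set ℝ) (ψ : ℝ → L2) : Prop :=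
  Tendsto (fun R : ℝ => limsup (fun h => ‖spectralProj h (Set.Ici R) (ψ h)‖) (𝓝[H] 0))
    atTop (𝓝 0)

/-- The geodesic flow `φ^s(x, ξ) = (x + s ξ, ξ)` on `T*𝕋²`. -/
def geodesicFlow (s : ℝ) (p : Phase) : Phase := (p.1 + toTorus (s • p.2), p.2)

end Loschmidt

open Loschmidt

/-!
The overlap of the free and of the perturbed evolution is followed by an approximately conserved
quantity. Put `τ = h / ε`, let `α_s(x, ξ)` be a family of symbols with compact support in `ξ`, and
consider the pairing `G(s) = ⟨Op_h(conj α_s) u(sτ), uε(sτ)⟩`, `s` between `0` and `t`. On the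
exponential `e_k` the standard quantization is multiplication by `conj α_s(x, 2πhk)`, so `G` is a
*finite* sum of pairings of `uε` with smooth test functions and can be differentiated with the weak
form of the equation (`hasDerivAt_mode`). The calculus is exact: `G'` is the same pairing for the symbol
`∂_s α + τ ξ · ∇α - i V α + (i τ h / 2) Δα` (`residual`), because `τ ε / h = 1` and `V` acts by left
multiplication.

The symbol is chosen equal to a cutoff `χ_R(ξ)` at `s = t`, where `G` is then the overlap up to the
mass of `ψ_h` at energies above `R` (`norm_inner_sub_pairing_le`).
* If `ε = h`, then `α_s = exp (-i ∫_0^{t-s} V ∘ φ^r dr) χ_R` solves the transport equation, and the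
  residual is `O(h)`.
* If `h ≪ ε`, then `α_s = exp (-i (t - s) V) χ_R` has residual `O(τ) + O(τ h)`.

Since `L²` bounds for `Op_h` are uniform in `h`, `G(t) - G(0) → 0` as `h → 0` for fixed `R`
(`norm_pairing_sub_le`). At `s = 0` the pairing is the conjugate of a Wigner distribution
(`pairing_zero`) of the symbol `exp (i ∫_0^t V ∘ φ^r dr) χ_R` or `exp (i t V) χ_R`, which converges by
the definition of the semiclassical measure. Finally `R → ∞` (`tendsto_overlap`).

The `L²` bound comes from the kernel: integration by parts in `ξ` bounds it by a rescaled integrable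
profile, uniformly in `x`, and Tonelli's theorem with Cauchy-Schwarz on the torus does the rest. The
same bound identifies the Wigner distribution of an arbitrary `L²` function with a finite Fourier sum
(`wigner_eq`). The solutions are only given in the weak sense, so conservation of their norm
(`IsSchrodingerSolution.norm_eq`) is proved through Fourier coefficients.
-/

namespace Loschmidt

open UnitAddTorus FourierTransform

/-! ### Lifts to the plane, exponentials and families of symbols -/

section

theorem toTorus_add (x y : Plane) : toTorus (x + y) = toTorus x + toTorus y := by
  ext i; simp [toTorus]

theorem toTorus_zero : toTorus 0 = 0 := by
  ext i; simp [toTorus]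

/-- The covering map is an open quotient map, so that functions on the torus may be studied through
their lifts. -/
theorem isOpenQuotientMap_toTorus : IsOpenQuotientMap toTorus := by
  have h1 : IsOpenQuotientMap (fun x : Fin 2 → ℝ => fun i => ((x i : ℝ) : UnitAddCircle)) :=
    IsOpenQuotientMap.piMap fun _ => QuotientAddGroup.isOpenQuotientMap_mk
  exact h1.comp (EuclideanSpace.equiv (Fin 2) ℝ).toHomeomorph.isOpenQuotientMap

@[fun_prop]
theorem continuous_toTorus : Continuous toTorus := isOpenQuotientMap_toTorus.continuous

theorem exists_toTorus_eq (q : Torus) : ∃ x : Plane, ‖x‖ ≤ 2 ∧ toTorus x = q := by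
  have h : ∀ i, ∃ y : ℝ, |y| ≤ 1 ∧ (y : UnitAddCircle) = q i := fun i => by
    obtain ⟨y, hy, h⟩ := (AddCircle.coe_image_Ico_eq (1 : ℝ) 0).symm.subset (Set.mem_univ (q i))
    exact ⟨y, abs_le.2 ⟨by linarith [hy.1], by linarith [hy.2]⟩, h⟩
  choose y hy1 hy2 using h
  refine ⟨WithLp.toLp 2 y, ?_, funext hy2⟩
  rw [EuclideanSpace.norm_eq, Real.sqrt_le_left (by norm_num)]
  simp only [Fin.sum_univ_two, Real.norm_eq_abs]
  nlinarith [hy1 0, hy1 1, abs_nonneg (y 0), abs_nonneg (y 1)]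

theorem TorusSmooth.continuous {F : Type*} [NormedAddCommGroup F] [NormedSpace ℝ F] {f : Torus → F}
    (hf : TorusSmooth f) : Continuous f :=
  isOpenQuotientMap_toTorus.isQuotientMap.continuous_iff.2 (ContDiff.continuous hf)

/-- The dual lattice vector `2πk`, for which `e_k(x) = exp (i ⟨x, 2πk⟩)`. -/
noncomputable def freq (k : Fin 2 → ℤ) : Plane := WithLp.toLp 2 fun i => 2 * Real.pi * k i

theorem freq_neg (k : Fin 2 → ℤ) : freq (-k) = -freq k := by
  ext i; simp [freq]

theorem norm_freq_sq (k : Fin 2 → ℤ) : ‖freq k‖ ^ 2 = 4 * Real.pi ^ 2 * ∑ i, (k i : ℝ) ^ 2 := by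
  rw [EuclideanSpace.norm_sq_eq]
  simp only [freq, Fin.sum_univ_two, Real.norm_eq_abs, sq_abs]
  ring

theorem mFourier_toTorus (k : Fin 2 → ℤ) (x : Plane) :
    mFourier k (toTorus x) = exp (I * (⟪x, freq k⟫_ℝ : ℝ)) := by
  simp only [mFourier, ContinuousMap.coe_mk, toTorus, fourier_coe_apply, Fin.prod_univ_two, ← exp_add,
    PiLp.inner_apply, Fin.sum_univ_two, freq]
  congr 1
  simp
  ring

theorem norm_mFourier_apply (k : Fin 2 → ℤ) (x : Torus) : ‖mFourier k x‖ = 1 := by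
  simp only [mFourier, fourier_apply, ContinuousMap.coe_mk, norm_prod, Circle.norm_coe,
    Finset.prod_const_one]

theorem mFourier_apply_add (k : Fin 2 → ℤ) (x y : Torus) :
    mFourier k (x + y) = mFourier k x * mFourier k y := by
  simp [mFourier, fourier_apply, AddCircle.toCircle_add, mul_mul_mul_comm]

/-- A one-parameter family of symbols whose lift is smooth jointly in the parameter, the position and
the momentum, and whose supports in `ξ` stay in a fixed ball. -/
structure IsSymbolFamily (r : ℝ → Phase → ℂ) : Prop where
  smooth : ContDiff ℝ ∞ (fun p : ℝ × Plane × Plane => r p.1 (toTorus p.2.1, p.2.2))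
  compactSupport : ∃ R : ℝ, ∀ s p, R < ‖p.2‖ → r s p = 0

theorem IsTestSymbol.isSymbolFamily {a : Phase → ℂ} (ha : IsTestSymbol a) :
    IsSymbolFamily fun _ => a := by
  refine ⟨ha.smooth.comp contDiff_snd, ?_⟩
  obtain ⟨R, hR⟩ := (ha.compactSupport.isCompact.image continuous_snd).isBounded.exists_norm_le
  refine ⟨R, fun _ p hp => ?_⟩
  by_contra h
  exact (hR p.2 ⟨p, subset_tsupport _ h, rfl⟩).not_gt hp

theorem IsSymbolFamily.isTestSymbol {r : ℝ → Phase → ℂ} (hr : IsSymbolFamily r) (s : ℝ) :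
    IsTestSymbol (r s) := by
  refine ⟨hr.smooth.comp (contDiff_const.prodMk contDiff_id), ?_⟩
  obtain ⟨R, hR⟩ := hr.compactSupport
  refine HasCompactSupport.intro (isCompact_univ.prod (isCompact_closedBall (0 : Plane) R))
    fun p hp => hR s p ?_
  simpa using hp

theorem IsSymbolFamily.continuous {r : ℝ → Phase → ℂ} (hr : IsSymbolFamily r) :
    Continuous fun p : ℝ × Phase => r p.1 p.2 := by
  have hq : IsOpenQuotientMap
      (Prod.map id (Prod.map toTorus id) : ℝ × Plane × Plane → ℝ × Torus × Plane) :=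
    .prodMap .id (.prodMap isOpenQuotientMap_toTorus .id)
  exact hq.isQuotientMap.continuous_iff.2 hr.smooth.continuous

theorem IsTestSymbol.continuous {a : Phase → ℂ} (ha : IsTestSymbol a) : Continuous a :=
  ha.isSymbolFamily.continuous.comp (by fun_prop : Continuous fun p : Phase => ((0 : ℝ), p))

theorem IsTestSymbol.contDiff_right {a : Phase → ℂ} (ha : IsTestSymbol a) (x : Torus) :
    ContDiff ℝ ∞ fun ξ : Plane => a (x, ξ) := by
  obtain ⟨y, rfl⟩ := isOpenQuotientMap_toTorus.surjective x
  exact ha.smooth.comp (contDiff_const.prodMk contDiff_id)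

/-- Derivatives in `ξ` of a family of symbols are bounded, uniformly in all variables as long as the
parameter stays bounded. -/
theorem IsSymbolFamily.exists_norm_iteratedFDeriv_le {r : ℝ → Phase → ℂ} (hr : IsSymbolFamily r)
    (T : ℝ) (n : ℕ) : ∃ C R : ℝ, 0 ≤ C ∧ ∀ s, |s| ≤ T → ∀ x ξ,
      ‖iteratedFDeriv ℝ n (fun ξ : Plane => r s (x, ξ)) ξ‖ ≤
        (Metric.closedBall (0 : Plane) R).indicator (fun _ => C) ξ := by
  obtain ⟨R, hR⟩ := hr.compactSupport
  set A := fun p : ℝ × Plane × Plane => r p.1 (toTorus p.2.1, p.2.2) with hA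
  have hcpt : IsCompact (Metric.closedBall (0 : ℝ) T ×ˢ
      Metric.closedBall (0 : Plane) 2 ×ˢ Metric.closedBall (0 : Plane) R) :=
    (isCompact_closedBall _ _).prod ((isCompact_closedBall _ _).prod (isCompact_closedBall _ _))
  obtain ⟨C, hC⟩ := hcpt.exists_bound_of_continuousOn
    (hr.smooth.continuous_iteratedFDeriv (m := n) (mod_cast le_top)).continuousOn
  refine ⟨max C 0, R, le_max_right _ _, fun s hs q ξ => ?_⟩
  by_cases hξ : ξ ∈ Metric.closedBall (0 : Plane) R
  · rw [Set.indicator_of_mem hξ]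
    obtain ⟨x, hx, rfl⟩ := exists_toTorus_eq q
    refine le_trans ?_ ((hC (s, x, ξ) ⟨by simpa using hs, by simpa using hx, hξ⟩).trans
      (le_max_left _ _))
    -- The derivatives in `ξ` are the restriction of those of the joint lift to the last factor.
    let L : Plane →L[ℝ] ℝ × Plane × Plane :=
      (ContinuousLinearMap.inr ℝ ℝ (Plane × Plane)).comp (ContinuousLinearMap.inr ℝ Plane Plane)
    have hL : ‖L‖ ≤ 1 := L.opNorm_le_bound zero_le_one fun v => by
      simp [L, Prod.norm_def]
    have e : (fun ξ : Plane => r s (toTorus x, ξ)) = (fun p => A ((s, x, 0) + p)) ∘ L := by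
      ext v; simp [L, hA]
    have hA' : ContDiff ℝ ∞ fun p => A ((s, x, 0) + p) :=
      hr.smooth.comp (contDiff_const.add contDiff_id)
    rw [e, L.iteratedFDeriv_comp_right hA' _ (mod_cast le_top),
      iteratedFDeriv_comp_add_left']
    refine (ContinuousMultilinearMap.norm_compContinuousLinearMap_le _ _).trans ?_
    have : (s, x, 0) + L ξ = (s, x, ξ) := by simp [L]
    simp only [this]
    refine mul_le_of_le_one_right (norm_nonneg _) ?_
    simpa using pow_le_one₀ (norm_nonneg _) hL
  · rw [Set.indicator_of_notMem hξ]
    have hev : (fun ξ : Plane => r s (q, ξ)) =ᶠ[𝓝 ξ] fun _ => 0 := by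
      filter_upwards [Metric.isClosed_closedBall.isOpen_compl.mem_nhds hξ] with η hη
      exact hR s (q, η) (by simpa using hη)
    rw [(hev.iteratedFDeriv ℝ n).eq_of_nhds]
    simp

/-- The inverse Fourier transform in `ξ` of a family of symbols decays like an integrable power,
uniformly in the position and for bounded values of the parameter. -/
theorem IsSymbolFamily.exists_norm_fourierInv_le {r : ℝ → Phase → ℂ} (hr : IsSymbolFamily r)
    (T : ℝ) : ∃ C : ℝ, 0 ≤ C ∧ ∀ s, |s| ≤ T → ∀ x (w : Plane),
      ‖𝓕⁻ (fun ξ : Plane => r s (x, ξ)) w‖ ≤ C * (1 + ‖w‖) ^ (-3 : ℝ) := by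
  choose C R hC0 hC using fun n => hr.exists_norm_iteratedFDeriv_le T n
  set D : ℝ := ∑ n ∈ Finset.range 4, C n * volume.real (Metric.closedBall (0 : Plane) (R n)) with hD
  have hD0 : 0 ≤ D := Finset.sum_nonneg fun n _ => mul_nonneg (hC0 n) measureReal_nonneg
  refine ⟨8 * (8 * D), by positivity, fun s hs x w => ?_⟩
  have hf := (hr.isTestSymbol s).contDiff_right x
  set f := fun ξ : Plane => r s (x, ξ) with hfdef
  have hind (n : ℕ) : Integrable ((Metric.closedBall (0 : Plane) (R n)).indicator fun _ => C n) :=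
    (integrable_indicator_iff Metric.isClosed_closedBall.measurableSet).2
      (integrableOn_const (measure_closedBall_lt_top).ne)
  have hint (n : ℕ) : Integrable fun v => ‖iteratedFDeriv ℝ n f v‖ :=
    (hind n).mono' (hf.continuous_iteratedFDeriv (m := n) (mod_cast le_top)).norm.aestronglyMeasurable
      (.of_forall fun v => by simpa using hC n s hs x v)
  have hint' (n : ℕ) : ∫ v, ‖iteratedFDeriv ℝ n f v‖ ≤
      C n * volume.real (Metric.closedBall (0 : Plane) (R n)) := by
    refine (integral_mono (hint n) (hind n) (hC n s hs x)).trans_eq ?_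
    rw [integral_indicator Metric.isClosed_closedBall.measurableSet, setIntegral_const, smul_eq_mul,
      mul_comm]
  have key (m : ℕ) (hm : m ≤ 3) (w : Plane) : ‖w‖ ^ m * ‖𝓕 f w‖ ≤ 8 * D := by
    have h := Real.pow_mul_norm_iteratedFDeriv_fourier_le (K := 0) (N := ⊤) (k := 0) (n := m) hf
      (fun k n hk _ => by
        obtain rfl : k = 0 := by simpa using hk
        simpa using hint n) le_rfl le_top w
    rw [norm_iteratedFDeriv_zero] at h
    refine h.trans ?_
    have h2 : ((2 : ℝ) * (0 : ℕ) + 2) ^ m ≤ 8 := by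
      calc ((2 : ℝ) * (0 : ℕ) + 2) ^ m = 2 ^ m := by norm_num
        _ ≤ 2 ^ 3 := pow_le_pow_right₀ (by norm_num) hm
        _ = 8 := by norm_num
    have h3 : ∑ p ∈ Finset.range (0 + 1) ×ˢ Finset.range (m + 1),
        ∫ v, ‖v‖ ^ p.1 * ‖iteratedFDeriv ℝ p.2 f v‖ ≤ D := by
      rw [Finset.sum_product]
      simp only [zero_add, Finset.range_one, Finset.sum_singleton, pow_zero, one_mul]
      refine (Finset.sum_le_sum fun n _ => hint' n).trans ?_
      exact Finset.sum_le_sum_of_subset_of_nonneg (Finset.range_mono (by omega))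
        fun n _ _ => mul_nonneg (hC0 n) measureReal_nonneg
    have h4 : 0 ≤ ∑ p ∈ Finset.range (0 + 1) ×ˢ Finset.range (m + 1),
        ∫ v, ‖v‖ ^ p.1 * ‖iteratedFDeriv ℝ p.2 f v‖ :=
      Finset.sum_nonneg fun p _ => integral_nonneg fun v => by positivity
    rw [pow_zero, one_mul]
    exact mul_le_mul h2 h3 h4 (by norm_num)
  rw [Real.fourierInv_eq_fourier_neg, Real.rpow_neg (by positivity), ← div_eq_mul_inv,
    le_div_iff₀ (by positivity), show (3 : ℝ) = (3 : ℕ) by norm_num, Real.rpow_natCast]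
  have h0 := key 0 (by norm_num) (-w)
  have h1 := key 1 (by norm_num) (-w)
  have h2 := key 2 (by norm_num) (-w)
  have h3 := key 3 (by norm_num) (-w)
  rw [norm_neg] at h0 h1 h2 h3
  nlinarith

end

/-! ### The standard quantization on `L²` and on exponentials -/

section

/-- `∫ (1 + |w|)⁻³ dw` over the plane. -/
noncomputable def decayIntegral : ℝ := ∫ w : Plane, (1 + ‖w‖) ^ (-3 : ℝ)

theorem decayIntegral_nonneg : 0 ≤ decayIntegral :=
  integral_nonneg fun w => Real.rpow_nonneg (by positivity) _

theorem integrable_decay : Integrable fun w : Plane => (1 + ‖w‖) ^ (-3 : ℝ) :=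
  integrable_one_add_norm (by simp; norm_num)

/-- The inverse Fourier transform in `ξ` of the symbol is `O((1 + |w|)⁻³)`, with constant `C`. -/
def HasDecay (C : ℝ) (a : Phase → ℂ) : Prop :=
  ∀ x (w : Plane), ‖𝓕⁻ (fun ξ : Plane => a (x, ξ)) w‖ ≤ C * (1 + ‖w‖) ^ (-3 : ℝ)

/-- The rescaled profile which dominates the kernel of `Op_h(a)` when `HasDecay C a`; its integral does
not depend on `h`. -/
noncomputable def kernelBound (C h : ℝ) (z : Plane) : ℝ :=
  ((2 * Real.pi * h) ^ 2)⁻¹ * (C * (1 + ‖(2 * Real.pi * h)⁻¹ • z‖) ^ (-3 : ℝ))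

variable {a : Phase → ℂ} {h C : ℝ}

theorem quantKernel_eq (a : Phase → ℂ) (hh : 0 < h) (x : Torus) (z : Plane) :
    quantKernel h a x z = ((2 * Real.pi * h : ℝ) : ℂ)⁻¹ ^ 2 *
      𝓕⁻ (fun ξ : Plane => a (x, ξ)) ((2 * Real.pi * h)⁻¹ • z) := by
  rw [quantKernel, Real.fourierInv_eq']
  congr 1
  refine integral_congr_ae (.of_forall fun ξ => ?_)
  simp only [smul_eq_mul]
  congr 2
  rw [inner_smul_right, real_inner_comm, mul_comm]
  congr 2
  have := Real.pi_pos
  field_simp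

theorem norm_quantKernel_le (hC : HasDecay C a) (hh : 0 < h) (x : Torus) (z : Plane) :
    ‖quantKernel h a x z‖ ≤ kernelBound C h z := by
  rw [quantKernel_eq a hh, norm_mul, norm_pow, norm_inv, Complex.norm_real, kernelBound,
    Real.norm_eq_abs, inv_pow, sq_abs]
  gcongr
  exact hC x _

theorem kernelBound_nonneg (hC : 0 ≤ C) (z : Plane) : 0 ≤ kernelBound C h z := by
  have : 0 ≤ (1 + ‖(2 * Real.pi * h)⁻¹ • z‖) ^ (-3 : ℝ) := Real.rpow_nonneg (by positivity) _
  unfold kernelBound; positivity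

theorem integrable_kernelBound (hh : 0 < h) : Integrable (kernelBound C h) := by
  have := Real.pi_pos
  exact (((integrable_decay.comp_smul (R := (2 * Real.pi * h)⁻¹) (by positivity)).const_mul
    C).const_mul _)

theorem integral_kernelBound (hh : 0 < h) : ∫ z, kernelBound C h z = C * decayIntegral := by
  have := Real.pi_pos
  simp only [kernelBound]
  rw [integral_const_mul, integral_const_mul,
    Measure.integral_comp_inv_smul volume (fun w : Plane => (1 + ‖w‖) ^ (-3 : ℝ)),
    finrank_euclideanSpace_fin, abs_of_nonneg (by positivity), smul_eq_mul, decayIntegral]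
  field_simp

theorem IsTestSymbol.continuous_quantKernel (ha : IsTestSymbol a) (h : ℝ) :
    Continuous fun p : Torus × Plane => quantKernel h a p.1 p.2 := by
  obtain ⟨R, hR⟩ := ha.isSymbolFamily.compactSupport
  have hc := ha.continuous
  have e (p : Torus × Plane) : ∫ ξ : Plane, exp (I * (⟪p.2, ξ⟫_ℝ / h : ℝ)) * a (p.1, ξ) =
      ∫ ξ in Metric.closedBall (0 : Plane) R, exp (I * (⟪p.2, ξ⟫_ℝ / h : ℝ)) * a (p.1, ξ) := by
    refine (setIntegral_eq_integral_of_forall_compl_eq_zero fun ξ hξ => ?_).symm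
    rw [hR 0 (p.1, ξ) (by simpa using hξ), mul_zero]
  simp only [quantKernel, e]
  refine continuous_const.mul (continuous_parametric_integral_of_continuous ?_
    (isCompact_closedBall _ _))
  fun_prop

theorem integrable_quantKernel (ha : IsTestSymbol a) (hC : HasDecay C a) (hh : 0 < h) (x : Torus) :
    Integrable (quantKernel h a x) :=
  (integrable_kernelBound hh).mono'
    ((ha.continuous_quantKernel h).comp (by fun_prop : Continuous fun z : Plane => (x, z))
      ).aestronglyMeasurable (.of_forall fun z => norm_quantKernel_le hC hh x z)

theorem mFourier_sub_toTorus (k : Fin 2 → ℤ) (x : Torus) (z : Plane) :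
    mFourier k (x - toTorus z) = mFourier k x * exp (-(I * (⟪z, freq k⟫_ℝ : ℝ))) := by
  rw [exp_neg, eq_mul_inv_iff_mul_eq₀ (exp_ne_zero _), ← mFourier_toTorus, ← mFourier_apply_add,
    sub_add_cancel]

/-- On exponentials, the standard quantization is multiplication by the symbol at the frequency:
this is Fourier inversion in `ξ`. -/
theorem integral_quantKernel_mul_mFourier (ha : IsTestSymbol a) (hC : HasDecay C a) (hh : 0 < h)
    (x : Torus) (k : Fin 2 → ℤ) :
    ∫ z, quantKernel h a x z * mFourier k (x - toTorus z) =
      a (x, h • freq k) * mFourier k x := by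
  have hpi := Real.pi_pos
  set f := fun ξ : Plane => a (x, ξ) with hf
  have hfc : Continuous f := (ha.contDiff_right x).continuous
  have hfs : HasCompactSupport f := by
    obtain ⟨R, hR⟩ := ha.isSymbolFamily.compactSupport
    exact HasCompactSupport.intro (isCompact_closedBall (0 : Plane) R)
      fun ξ hξ => hR 0 (x, ξ) (by simpa using hξ)
  have hfi : Integrable f := hfc.integrable_of_hasCompactSupport hfs
  have hfi' : Integrable (𝓕⁻ f) := by
    have h1 := (integrable_quantKernel ha hC hh x).const_mul (((2 * Real.pi * h : ℝ) : ℂ) ^ 2)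
    have h2 : (fun z => ((2 * Real.pi * h : ℝ) : ℂ) ^ 2 * quantKernel h a x z) =
        fun z => 𝓕⁻ f ((2 * Real.pi * h)⁻¹ • z) := by
      ext z
      have : ((2 * Real.pi * h : ℝ) : ℂ) ≠ 0 := by
        simpa using And.intro hpi.ne' hh.ne'
      rw [quantKernel_eq a hh, ← mul_assoc, ← mul_pow, mul_inv_cancel₀ this, one_pow, one_mul]
    rw [h2] at h1
    exact (integrable_comp_smul_iff volume _ (by positivity)).1 h1
  have hfi'' : Integrable (𝓕 f) := by
    have := hfi'.comp_neg
    simpa only [Real.fourierInv_eq_fourier_neg, neg_neg] using this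
  have hinv := hfi.fourier_fourierInv_eq hfi'' (v := h • freq k) hfc.continuousAt
  rw [Real.fourier_eq'] at hinv
  obtain ⟨F, hF⟩ : ∃ F, F = fun w => exp ((-2 * Real.pi * ⟪w, h • freq k⟫_ℝ : ℝ) * I) • 𝓕⁻ f w :=
    ⟨_, rfl⟩
  have e (z : Plane) : quantKernel h a x z * mFourier k (x - toTorus z) =
      (((2 * Real.pi * h : ℝ) : ℂ)⁻¹ ^ 2 * mFourier k x) *
        F ((2 * Real.pi * h)⁻¹ • z) := by
    rw [quantKernel_eq a hh, mFourier_sub_toTorus, ← hf, hF]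
    simp only [smul_eq_mul, inner_smul_left, inner_smul_right]
    have : (-(I * (⟪z, freq k⟫_ℝ : ℝ)) : ℂ) = ((-2 * Real.pi * ((starRingEnd ℝ) (2 * Real.pi * h)⁻¹ *
        (h * ⟪z, freq k⟫_ℝ)) : ℝ) : ℂ) * I := by
      rw [show (-2 * Real.pi * ((starRingEnd ℝ) (2 * Real.pi * h)⁻¹ *
        (h * ⟪z, freq k⟫_ℝ)) : ℝ) = -⟪z, freq k⟫_ℝ by
          simp only [conj_trivial]; field_simp]
      push_cast; ring
    rw [this]; ring_nf
  simp_rw [e]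
  rw [integral_const_mul, Measure.integral_comp_inv_smul, finrank_euclideanSpace_fin,
    abs_of_nonneg (by positivity), hF, hinv, real_smul]
  have hpi' : (Real.pi : ℂ) ≠ 0 := mod_cast hpi.ne'
  have hh' : (h : ℂ) ≠ 0 := mod_cast hh.ne'
  rw [hf]
  push_cast
  field_simp

/-- The trigonometric polynomial `∑ c_k e_k`. -/
noncomputable def trigPoly (K : Finset (Fin 2 → ℤ)) (c : (Fin 2 → ℤ) → ℂ) : C(Torus, ℂ) :=
  ∑ k ∈ K, c k • mFourier k

theorem trigPoly_apply (K : Finset (Fin 2 → ℤ)) (c : (Fin 2 → ℤ) → ℂ) (x : Torus) :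
    trigPoly K c x = ∑ k ∈ K, c k * mFourier k x := by
  simp [trigPoly, ContinuousMap.sum_apply]

theorem quantization_trigPoly (ha : IsTestSymbol a) (hC : HasDecay C a) (hh : 0 < h)
    (K : Finset (Fin 2 → ℤ)) (c : (Fin 2 → ℤ) → ℂ) (x : Torus) :
    quantization h a (trigPoly K c) x =
      ∑ k ∈ K, c k * (a (x, h • freq k) * mFourier k x) := by
  simp only [quantization, trigPoly_apply, Finset.mul_sum]
  rw [integral_finsetSum]
  · refine Finset.sum_congr rfl fun k _ => ?_
    rw [← integral_quantKernel_mul_mFourier ha hC hh, ← integral_const_mul]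
    exact integral_congr_ae (.of_forall fun z => by ring)
  · intro k _
    refine (integrable_quantKernel ha hC hh x).mul_bdd (c := ‖c k‖) ?_ (.of_forall fun z => ?_)
    · exact Continuous.aestronglyMeasurable (by fun_prop)
    · simp [norm_mFourier_apply]

theorem norm_toLp_trigPoly_sq (K : Finset (Fin 2 → ℤ)) (c : (Fin 2 → ℤ) → ℂ) :
    ‖ContinuousMap.toLp 2 torusMeasure ℂ (trigPoly K c)‖ ^ 2 = ∑ k ∈ K, ‖c k‖ ^ 2 := by
  have ho : Orthonormal ℂ fun k : Fin 2 → ℤ =>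
      ContinuousMap.toLp 2 torusMeasure ℂ (mFourier k) := orthonormal_mFourier
  have := ho.inner_sum c c K
  rw [trigPoly, map_sum]
  simp only [map_smul]
  rw [← inner_self_eq_norm_sq (𝕜 := ℂ), this, map_sum]
  refine Finset.sum_congr rfl fun k _ => ?_
  rw [← Complex.normSq_eq_conj_mul_self, Complex.normSq_eq_norm_sq]
  exact Complex.ofReal_re _

/-- Tonelli's theorem, translation invariance and Cauchy-Schwarz on the torus: the kernel of the
standard quantization acts on `L²` with norm at most the integral of its profile. -/
theorem lintegral_quantKernel_le (hC0 : 0 ≤ C) (hC : HasDecay C a)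
    (hh : 0 < h) {w u : Torus → ℂ} (hw : StronglyMeasurable w) (hu : StronglyMeasurable u) :
    ∫⁻ p : Torus × Plane, ‖w p.1 * (quantKernel h a p.1 p.2 * u (p.1 - toTorus p.2))‖ₑ
      ∂(torusMeasure.prod volume) ≤
    ENNReal.ofReal (C * decayIntegral) * (eLpNorm w 2 torusMeasure * eLpNorm u 2 torusMeasure) := by
  have hG : Measurable fun z : Plane => ENNReal.ofReal (kernelBound C h z) := by
    unfold kernelBound
    fun_prop
  have hum : Measurable fun p : Torus × Plane => ‖u (p.1 - toTorus p.2)‖ₑ :=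
    (hu.measurable.comp (by fun_prop : Continuous fun p : Torus × Plane =>
      p.1 - toTorus p.2).measurable).enorm
  have hwm : Measurable fun p : Torus × Plane => ‖w p.1‖ₑ := (hw.measurable.comp measurable_fst).enorm
  calc _ ≤ ∫⁻ p : Torus × Plane, ENNReal.ofReal (kernelBound C h p.2) *
        (‖w p.1‖ₑ * ‖u (p.1 - toTorus p.2)‖ₑ) ∂(torusMeasure.prod volume) := by
        refine lintegral_mono fun p => ?_
        rw [enorm_mul, enorm_mul, mul_left_comm]
        gcongr
        rw [← ofReal_norm]
        exact ENNReal.ofReal_le_ofReal (norm_quantKernel_le hC hh _ _)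
    _ = ∫⁻ z : Plane, ENNReal.ofReal (kernelBound C h z) *
        ∫⁻ x, ‖w x‖ₑ * ‖u (x - toTorus z)‖ₑ ∂torusMeasure := by
        have hm : Measurable fun p : Torus × Plane => ENNReal.ofReal (kernelBound C h p.2) *
            (‖w p.1‖ₑ * ‖u (p.1 - toTorus p.2)‖ₑ) := (hG.comp measurable_snd).mul (hwm.mul hum)
        rw [lintegral_prod_symm _ hm.aemeasurable]
        refine lintegral_congr fun z => ?_
        have hz : Measurable fun x : Torus => ‖w x‖ₑ * ‖u (x - toTorus z)‖ₑ :=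
          hw.measurable.enorm.mul (hum.comp (by fun_prop : Measurable fun x : Torus => (x, z)))
        exact lintegral_const_mul (μ := torusMeasure) (ENNReal.ofReal (kernelBound C h z)) hz
    _ ≤ ∫⁻ z : Plane, ENNReal.ofReal (kernelBound C h z) *
        (eLpNorm w 2 torusMeasure * eLpNorm u 2 torusMeasure) := by
        refine lintegral_mono fun z => ?_
        gcongr
        have hmp : MeasurePreserving (fun x : Torus => x - toTorus z) torusMeasure torusMeasure :=
          measurePreserving_sub_right torusMeasure (toTorus z)
        rw [← eLpNorm_comp_measurePreserving hu.aestronglyMeasurable hmp]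
        have := ENNReal.lintegral_mul_le_Lp_mul_Lq torusMeasure (p := 2) (q := 2)
          Real.HolderConjugate.two_two hw.measurable.enorm.aemeasurable
          (hum.comp (by fun_prop : Measurable fun x : Torus => (x, z))).aemeasurable
        simpa [eLpNorm_eq_lintegral_rpow_enorm_toReal] using this
    _ = _ := by
        rw [lintegral_mul_const _ hG, ← ofReal_integral_eq_lintegral_ofReal
          (integrable_kernelBound hh) (.of_forall fun z => kernelBound_nonneg hC0 z),
          integral_kernelBound hh]

theorem integrable_mul_quantKernel (ha : IsTestSymbol a) (hC0 : 0 ≤ C) (hC : HasDecay C a)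
    (hh : 0 < h) {w u : Torus → ℂ} (hw : StronglyMeasurable w) (hu : StronglyMeasurable u)
    (hw2 : MemLp w 2 torusMeasure) (hu2 : MemLp u 2 torusMeasure) :
    Integrable (fun p : Torus × Plane => w p.1 * (quantKernel h a p.1 p.2 * u (p.1 - toTorus p.2)))
      (torusMeasure.prod volume) := by
  refine ⟨?_, ?_⟩
  · exact ((hw.comp_measurable measurable_fst).mul ((ha.continuous_quantKernel h).stronglyMeasurable.mul
      (hu.comp_measurable (by fun_prop : Continuous fun p : Torus × Plane =>
      p.1 - toTorus p.2).measurable))).aestronglyMeasurable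
  · exact (lintegral_quantKernel_le hC0 hC hh hw hu).trans_lt
      (ENNReal.mul_lt_top ENNReal.ofReal_lt_top (ENNReal.mul_lt_top hw2.2 hu2.2))

theorem integral_mul_quantization (ha : IsTestSymbol a) (hC0 : 0 ≤ C) (hC : HasDecay C a)
    (hh : 0 < h) {w u : Torus → ℂ} (hw : StronglyMeasurable w) (hu : StronglyMeasurable u)
    (hw2 : MemLp w 2 torusMeasure) (hu2 : MemLp u 2 torusMeasure) :
    ∫ x, w x * quantization h a u x ∂torusMeasure =
      ∫ p : Torus × Plane, w p.1 * (quantKernel h a p.1 p.2 * u (p.1 - toTorus p.2))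
      ∂(torusMeasure.prod volume) := by
  rw [integral_prod _ (integrable_mul_quantKernel ha hC0 hC hh hw hu hw2 hu2)]
  simp only [integral_const_mul, quantization]

/-- `L²` boundedness of the standard quantization, with a constant independent of `h`. -/
theorem norm_integral_mul_quantization_le (ha : IsTestSymbol a) (hC0 : 0 ≤ C) (hC : HasDecay C a)
    (hh : 0 < h) {w u : Torus → ℂ} (hw : StronglyMeasurable w) (hu : StronglyMeasurable u)
    (hw2 : MemLp w 2 torusMeasure) (hu2 : MemLp u 2 torusMeasure) :
    ‖∫ x, w x * quantization h a u x ∂torusMeasure‖ ≤ C * decayIntegral *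
      ((eLpNorm w 2 torusMeasure).toReal * (eLpNorm u 2 torusMeasure).toReal) := by
  rw [integral_mul_quantization ha hC0 hC hh hw hu hw2 hu2]
  refine (norm_integral_le_lintegral_norm _).trans ?_
  simp only [ofReal_norm]
  refine (ENNReal.toReal_mono ?_ (lintegral_quantKernel_le hC0 hC hh hw hu)).trans_eq ?_
  · exact ENNReal.mul_ne_top ENNReal.ofReal_ne_top (ENNReal.mul_ne_top hw2.2.ne hu2.2.ne)
  · rw [ENNReal.toReal_mul, ENNReal.toReal_mul, ENNReal.toReal_ofReal
      (mul_nonneg hC0 decayIntegral_nonneg)]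

theorem memLp_conj (w : L2) : MemLp (fun x => starRingEnd ℂ (w x)) 2 torusMeasure :=
  (Lp.memLp w).star

theorem stronglyMeasurable_conj (w : L2) : StronglyMeasurable fun x => starRingEnd ℂ (w x) :=
  (Lp.stronglyMeasurable w).star

theorem toReal_eLpNorm_conj (w : L2) :
    (eLpNorm (fun x => starRingEnd ℂ (w x)) 2 torusMeasure).toReal = ‖w‖ := by
  rw [Lp.norm_def]
  congr 1
  exact eLpNorm_congr_norm_ae (.of_forall fun x => by simp)

theorem toReal_eLpNorm_continuousMap (f : C(Torus, ℂ)) :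
    (eLpNorm f 2 torusMeasure).toReal = ‖ContinuousMap.toLp 2 torusMeasure ℂ f‖ := by
  rw [Lp.norm_def]
  congr 1
  exact eLpNorm_congr_ae (ContinuousMap.coeFn_toLp torusMeasure f).symm

theorem memLp_continuousMap (f : C(Torus, ℂ)) : MemLp f 2 torusMeasure :=
  (Lp.memLp (ContinuousMap.toLp 2 torusMeasure ℂ f)).ae_eq (ContinuousMap.coeFn_toLp torusMeasure f)

/-- `L²` boundedness of the quantization, tested on trigonometric polynomials. -/
theorem norm_integral_conj_mul_sum_le (ha : IsTestSymbol a) (hC0 : 0 ≤ C) (hC : HasDecay C a)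
    (hh : 0 < h) (w : L2) (K : Finset (Fin 2 → ℤ)) (c : (Fin 2 → ℤ) → ℂ) :
    ‖∫ x, starRingEnd ℂ (w x) * ∑ k ∈ K, c k * (a (x, h • freq k) * mFourier k x) ∂torusMeasure‖ ≤
      C * decayIntegral * (‖w‖ * √(∑ k ∈ K, ‖c k‖ ^ 2)) := by
  have := norm_integral_mul_quantization_le ha hC0 hC hh (stronglyMeasurable_conj w)
    (trigPoly K c).continuous.stronglyMeasurable (memLp_conj w) (memLp_continuousMap _)
  rw [toReal_eLpNorm_conj, toReal_eLpNorm_continuousMap] at this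
  simp only [quantization_trigPoly ha hC hh] at this
  rwa [← norm_toLp_trigPoly_sq, Real.sqrt_sq (norm_nonneg _)]

/-- For a compactly supported symbol, the Wigner distribution only involves the finitely many
Fourier modes in the support of the symbol. -/
theorem wigner_eq (ha : IsTestSymbol a) (hh : 0 < h) (ψ : L2) (K : Finset (Fin 2 → ℤ))
    (hK : ∀ k ∉ K, ∀ x, a (x, h • freq k) = 0) :
    wigner h ψ a = ∫ x, starRingEnd ℂ (ψ x) *
      ∑ k ∈ K, mFourierCoeff ψ k * (a (x, h • freq k) * mFourier k x) ∂torusMeasure := by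
  obtain ⟨C, hC0, hC⟩ := ha.isSymbolFamily.exists_norm_fourierInv_le 0
  replace hC : HasDecay C a := hC 0 (by simp)
  set c := mFourierCoeff (ψ : Torus → ℂ) with hc
  have hsum : Tendsto (fun K' : Finset (Fin 2 → ℤ) =>
      ‖ψ - ContinuousMap.toLp 2 torusMeasure ℂ (trigPoly K' c)‖) atTop (𝓝 0) := by
    have h1 : HasSum (fun k => c k • ContinuousMap.toLp 2 torusMeasure ℂ (mFourier k)) ψ :=
      hasSum_mFourier_series_L2 ψ
    have h2 := (h1.const_sub ψ).norm
    simpa [trigPoly, map_sum] using h2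
  -- Enlarging the set of modes does not change the right-hand side.
  have hle : ∀ᶠ K' : Finset (Fin 2 → ℤ) in atTop, ‖wigner h ψ a - ∫ x, starRingEnd ℂ (ψ x) *
      ∑ k ∈ K, c k * (a (x, h • freq k) * mFourier k x) ∂torusMeasure‖ ≤
      C * decayIntegral * (‖ψ‖ * ‖ψ - ContinuousMap.toLp 2 torusMeasure ℂ (trigPoly K' c)‖) := by
    filter_upwards [eventually_ge_atTop K] with K' hKK
    have e (x : Torus) : ∑ k ∈ K, c k * (a (x, h • freq k) * mFourier k x) =
        quantization h a (trigPoly K' c) x := by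
      rw [quantization_trigPoly ha hC hh]
      refine Finset.sum_subset hKK fun k _ hk => ?_
      rw [hK k hk x, zero_mul, mul_zero]
    have m1 := stronglyMeasurable_conj ψ
    have m2 := memLp_conj ψ
    have m3 := Lp.stronglyMeasurable ψ
    have m4 := Lp.memLp ψ
    have m5 := (trigPoly K' c).continuous.stronglyMeasurable
    have m6 := memLp_continuousMap (trigPoly K' c)
    have m7 : StronglyMeasurable fun x => ψ x - trigPoly K' c x := m3.sub m5
    have m8 : MemLp (fun x => ψ x - trigPoly K' c x) 2 torusMeasure := m4.sub m6
    simp only [e, wigner]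
    have hd : (eLpNorm (fun x => ψ x - trigPoly K' c x) 2 torusMeasure).toReal =
        ‖ψ - ContinuousMap.toLp 2 torusMeasure ℂ (trigPoly K' c)‖ := by
      rw [Lp.norm_def]
      congr 1
      refine eLpNorm_congr_ae ?_
      filter_upwards [Lp.coeFn_sub ψ (ContinuousMap.toLp 2 torusMeasure ℂ (trigPoly K' c)),
        ContinuousMap.coeFn_toLp (𝕜 := ℂ) (p := 2) torusMeasure (trigPoly K' c)] with x h1 h2
      rw [h1, Pi.sub_apply, h2]
    rw [← toReal_eLpNorm_conj ψ, ← hd]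
    refine le_trans (le_of_eq ?_) (norm_integral_mul_quantization_le ha hC0 hC hh m1 m7 m2 m8)
    rw [integral_mul_quantization ha hC0 hC hh m1 m3 m2 m4,
      integral_mul_quantization ha hC0 hC hh m1 m5 m2 m6,
      integral_mul_quantization ha hC0 hC hh m1 m7 m2 m8,
      ← integral_sub (integrable_mul_quantKernel ha hC0 hC hh m1 m3 m2 m4)
        (integrable_mul_quantKernel ha hC0 hC hh m1 m5 m2 m6)]
    congr 2
    ext p
    ring
  have hlim := ((hsum.const_mul ‖ψ‖).const_mul (C * decayIntegral))
  rw [mul_zero, mul_zero] at hlim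
  have := ge_of_tendsto hlim hle
  exact sub_eq_zero.1 (norm_le_zero_iff.1 this)

end

/-! ### Derivatives on the torus and weak solutions -/

section

/-- The derivative of `f` in the direction `v`, with value `0` where `f` is not differentiable. -/
noncomputable def dirDeriv {E : Type*} [NormedAddCommGroup E] [NormedSpace ℝ E] (v : E) (f : E → ℂ)
    (y : E) : ℂ := fderiv ℝ f y v

section dirDeriv

variable {E : Type*} [NormedAddCommGroup E] [NormedSpace ℝ E] {f g : E → ℂ}

theorem contDiff_dirDeriv (hf : ContDiff ℝ ∞ f) (v : E) : ContDiff ℝ ∞ (dirDeriv v f) :=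
  (hf.fderiv_right (m := ∞) (by simp)).clm_apply contDiff_const

theorem dirDeriv_const (v : E) (c : ℂ) : dirDeriv v (fun _ => c) = fun _ => 0 := by
  ext y; simp [dirDeriv]

theorem dirDeriv_mul (hf : ContDiff ℝ ∞ f) (hg : ContDiff ℝ ∞ g) (v : E) :
    dirDeriv v (fun y => f y * g y) = fun y => dirDeriv v f y * g y + f y * dirDeriv v g y := by
  ext y
  rw [dirDeriv, fderiv_fun_mul (hf.differentiable (by simp) y) (hg.differentiable (by simp) y)]
  simp [dirDeriv]
  ring

theorem dirDeriv_add (hf : ContDiff ℝ ∞ f) (hg : ContDiff ℝ ∞ g) (v : E) :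
    dirDeriv v (fun y => f y + g y) = fun y => dirDeriv v f y + dirDeriv v g y := by
  ext y
  rw [dirDeriv, fderiv_fun_add (hf.differentiable (by simp) y) (hg.differentiable (by simp) y)]
  simp [dirDeriv]

theorem dirDeriv_comp {E' : Type*} [NormedAddCommGroup E'] [NormedSpace ℝ E'] (L : E' →L[ℝ] E)
    (hf : ContDiff ℝ ∞ f) (p : E) (v : E') :
    dirDeriv v (fun y => f (p + L y)) = fun y => dirDeriv (L v) f (p + L y) := by
  ext y
  have h1 : HasFDerivAt (fun y => p + L y) L y := L.hasFDerivAt.const_add p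
  have h2 := ((hf.differentiable (by simp) (p + L y)).hasFDerivAt).comp y h1
  rw [dirDeriv, dirDeriv]
  exact DFunLike.congr_fun h2.fderiv v

theorem hasDerivAt_line (hf : ContDiff ℝ ∞ f) (p v : E) (t : ℝ) :
    HasDerivAt (fun s : ℝ => f (p + s • v)) (dirDeriv v f (p + t • v)) t := by
  have h1 : HasDerivAt (fun s : ℝ => p + s • v) v t := by
    simpa using ((hasDerivAt_id t).smul_const v).const_add p
  exact ((hf.differentiable (by simp) (p + t • v)).hasFDerivAt).comp_hasDerivAt t h1

end dirDeriv

theorem laplacian_eq_sum_dirDeriv {f : Plane → ℂ} (hf : ContDiff ℝ ∞ f) (y : Plane) :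
    Δ f y = ∑ i, dirDeriv (EuclideanSpace.basisFun (Fin 2) ℝ i)
      (dirDeriv (EuclideanSpace.basisFun (Fin 2) ℝ i) f) y := by
  rw [InnerProductSpace.laplacian_eq_iteratedFDeriv_orthonormalBasis f
    (EuclideanSpace.basisFun (Fin 2) ℝ)]
  refine Finset.sum_congr rfl fun i _ => ?_
  rw [iteratedFDeriv_two_apply]
  have h : DifferentiableAt ℝ (fderiv ℝ f) y :=
    (hf.fderiv_right (m := ∞) (by simp)).differentiable (by simp) y
  unfold dirDeriv
  rw [fderiv_clm_apply h (differentiableAt_const _)]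
  simp

/-- The derivative of a function on the torus at `x` in the direction `v`. -/
noncomputable def torusDeriv (f : Torus → ℂ) (x : Torus) (v : Plane) : ℂ :=
  dirDeriv v (fun y : Plane => f (x + toTorus y)) 0

theorem TorusSmooth.contDiff_add {F : Type*} [NormedAddCommGroup F] [NormedSpace ℝ F] {f : Torus → F}
    (hf : TorusSmooth f) (x : Torus) : ContDiff ℝ ∞ fun y : Plane => f (x + toTorus y) := by
  obtain ⟨z, rfl⟩ := isOpenQuotientMap_toTorus.surjective x
  simp only [← toTorus_add]
  have hf' : ContDiff ℝ ∞ fun y : Plane => f (toTorus y) := hf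
  have := hf'.comp ((contDiff_const (c := z)).add contDiff_id)
  exact this

theorem contDiff_inner_exp (c : ℂ) (η : Plane) :
    ContDiff ℝ ∞ fun y : Plane => c * exp (I * (⟪y, η⟫_ℝ : ℝ)) :=
  contDiff_const.mul ((contDiff_const.mul
    (Complex.ofRealCLM.contDiff.comp (contDiff_id.inner ℝ contDiff_const))).cexp)

theorem dirDeriv_inner_exp (c : ℂ) (η v : Plane) :
    dirDeriv v (fun y : Plane => c * exp (I * (⟪y, η⟫_ℝ : ℝ))) =
      fun y => I * (⟪v, η⟫_ℝ : ℝ) * (c * exp (I * (⟪y, η⟫_ℝ : ℝ))) := by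
  ext y
  have h := hasDerivAt_line (contDiff_inner_exp c η) y v 0
  rw [zero_smul, add_zero] at h
  refine h.unique ?_
  have h1 : HasDerivAt (fun s : ℝ => ⟪y + s • v, η⟫_ℝ) ⟪v, η⟫_ℝ 0 := by
    simp only [inner_add_left, inner_smul_left, conj_trivial]
    simpa using ((hasDerivAt_id (0 : ℝ)).mul_const ⟪v, η⟫_ℝ).const_add ⟪y, η⟫_ℝ
  have h2 := ((h1.ofReal_comp.const_mul I).cexp).const_mul c
  convert! h2 using 1
  simp only [zero_smul, add_zero]
  ring

theorem torusLaplacian_mul_mFourier {α : Torus → ℂ} (hα : TorusSmooth α) (k : Fin 2 → ℤ) (x : Torus) :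
    torusLaplacian (fun x => α x * mFourier k x) x =
      (torusLaplacian α x + 2 * I * torusDeriv α x (freq k) - (‖freq k‖ ^ 2 : ℝ) * α x) *
        mFourier k x := by
  have hA := hα.contDiff_add x
  have hE := contDiff_inner_exp (mFourier k x) (freq k)
  have e (y : Plane) : α (x + toTorus y) * mFourier k (x + toTorus y) =
      α (x + toTorus y) * (mFourier k x * exp (I * (⟪y, freq k⟫_ℝ : ℝ))) := by
    rw [mFourier_apply_add, mFourier_toTorus]
  have hgrad : torusDeriv α x (freq k) = ∑ i, (freq k i : ℂ) *
      dirDeriv (EuclideanSpace.basisFun (Fin 2) ℝ i) (fun y : Plane => α (x + toTorus y)) 0 := by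
    have := (EuclideanSpace.basisFun (Fin 2) ℝ).sum_repr (freq k)
    rw [torusDeriv, dirDeriv]
    conv_lhs => rw [← this]
    rw [map_sum]
    refine Finset.sum_congr rfl fun i _ => ?_
    rw [map_smul, dirDeriv]
    simp
  simp only [torusLaplacian, e]
  rw [laplacian_eq_sum_dirDeriv (hA.mul hE), laplacian_eq_sum_dirDeriv hA, hgrad,
    EuclideanSpace.norm_sq_eq, ofReal_sum, Finset.mul_sum, Finset.sum_mul, ← Finset.sum_add_distrib,
    ← Finset.sum_sub_distrib, Finset.sum_mul]
  refine Finset.sum_congr rfl fun i _ => ?_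
  set v := EuclideanSpace.basisFun (Fin 2) ℝ i with hv
  have hvi : ⟪v, freq k⟫_ℝ = freq k i := by
    rw [hv, EuclideanSpace.basisFun_apply, EuclideanSpace.inner_single_left]
    simp
  rw [dirDeriv_mul hA hE, dirDeriv_inner_exp,
    dirDeriv_add ((contDiff_dirDeriv hA v).mul hE) (hA.mul (contDiff_const.mul hE)),
    dirDeriv_mul (contDiff_dirDeriv hA v) hE, dirDeriv_mul hA (contDiff_const.mul hE),
    dirDeriv_mul contDiff_const hE, dirDeriv_inner_exp, hvi]
  have hc : dirDeriv v (fun _ : Plane => I * (freq k i : ℂ)) 0 = 0 := by rw [dirDeriv_const]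
  simp only [hc, inner_zero_left, ofReal_zero, mul_zero, exp_zero, toTorus_zero, add_zero,
    Real.norm_eq_abs, sq_abs, ofReal_pow]
  linear_combination (α x * (freq k i : ℂ) ^ 2 * mFourier k x) * I_sq

theorem torusSmooth_mFourier (k : Fin 2 → ℤ) : TorusSmooth (mFourier k : Torus → ℂ) := by
  unfold TorusSmooth
  simp only [mFourier_toTorus]
  simpa using contDiff_inner_exp 1 (freq k)

theorem torusLaplacian_mFourier (k : Fin 2 → ℤ) (x : Torus) :
    torusLaplacian (mFourier k) x = -(‖freq k‖ ^ 2 : ℝ) * mFourier k x := by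
  have h := torusLaplacian_mul_mFourier (α := fun _ => 1) contDiff_const k x
  have h1 : torusLaplacian (fun _ => 1) x = 0 := by
    rw [torusLaplacian, laplacian_eq_sum_dirDeriv contDiff_const]
    simp [dirDeriv_const]
  have h2 : torusDeriv (fun _ => 1) x (freq k) = 0 := by simp [torusDeriv, dirDeriv_const]
  simp only [h1, h2, one_mul] at h
  rw [show (mFourier k : Torus → ℂ) = fun x => mFourier k x from rfl, h]
  ring

theorem integral_mul_eq_inner (f : C(Torus, ℂ)) (w : L2) :
    ∫ x, f x * w x ∂torusMeasure = ⟪ContinuousMap.toLp 2 torusMeasure ℂ (star f), w⟫_ℂ := by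
  rw [L2.inner_def]
  refine integral_congr_ae ?_
  filter_upwards [ContinuousMap.coeFn_toLp (𝕜 := ℂ) (p := 2) torusMeasure (star f)] with x hx
  rw [hx]
  simp [mul_comm]

theorem inner_eq_integral (v w : L2) :
    ⟪v, w⟫_ℂ = ∫ x, starRingEnd ℂ (v x) * w x ∂torusMeasure := by
  rw [L2.inner_def]
  simp [mul_comm]

theorem hasSum_norm_sq_mFourierCoeff (w : L2) :
    HasSum (fun k => ‖mFourierCoeff w k‖ ^ 2) (‖w‖ ^ 2) := by
  have h : HasSum (fun k => starRingEnd ℂ (mFourierCoeff w k) * mFourierCoeff w k)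
    (∫ x, starRingEnd ℂ (w x) * w x ∂torusMeasure) := hasSum_prod_mFourierCoeff w w
  rw [← inner_eq_integral, inner_self_eq_norm_sq_to_K] at h
  have h2 := RCLike.hasSum_re ℂ h
  convert! h2 using 1
  · ext k
    rw [← Complex.normSq_eq_conj_mul_self, Complex.normSq_eq_norm_sq]
    exact (Complex.ofReal_re _).symm
  · norm_cast

theorem mFourierCoeff_eq (w : Torus → ℂ) (k : Fin 2 → ℤ) :
    mFourierCoeff w k = ∫ x, mFourier (-k) x * w x ∂torusMeasure := rfl

section Solutions

variable {h : ℝ} {W : Torus → ℝ} {ψ : L2} {u : ℝ → L2}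

theorem memLp_real_mul (hW : Continuous W) (w : L2) :
    MemLp (fun x => (W x : ℂ) * w x) 2 torusMeasure := by
  obtain ⟨B, hB⟩ := isCompact_univ.exists_bound_of_continuousOn hW.continuousOn
  refine (Lp.memLp w).of_le_mul (c := B) ?_ (.of_forall fun x => ?_)
  · exact (continuous_ofReal.comp hW).aestronglyMeasurable.mul (Lp.aestronglyMeasurable w)
  · rw [norm_mul]
    gcongr
    simpa using hB x (Set.mem_univ x)

theorem integrable_continuous_mul {f : Torus → ℂ} (hf : Continuous f) (w : L2) :
    Integrable (fun x => f x * w x) torusMeasure := by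
  obtain ⟨B, hB⟩ := isCompact_univ.exists_bound_of_continuousOn hf.continuousOn
  exact ((Lp.memLp w).integrable one_le_two).bdd_mul hf.aestronglyMeasurable
    (.of_forall fun x => hB x (Set.mem_univ x))

theorem IsSchrodingerSolution.hasDerivAt_mFourierCoeff (hu : IsSchrodingerSolution h W ψ u)
    (hW : Continuous W) (hh : 0 < h) (k : Fin 2 → ℤ) (t : ℝ) :
    HasDerivAt (fun s => mFourierCoeff (u s) k)
      ((I * h)⁻¹ * ((h ^ 2 / 2 * ‖freq k‖ ^ 2 : ℝ) * mFourierCoeff (u t) k +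
        mFourierCoeff (fun x => W x * u t x) k)) t := by
  have hI : I * (h : ℂ) ≠ 0 := mul_ne_zero I_ne_zero (mod_cast hh.ne')
  have h1 := (hu.equation (mFourier (-k)) (torusSmooth_mFourier (-k)) t).const_mul (I * h : ℂ)⁻¹
  simp only [← mFourierCoeff_eq, inv_mul_cancel_left₀ hI] at h1
  convert! h1 using 2
  rw [mFourierCoeff_eq, mFourierCoeff_eq, ← integral_const_mul, ← integral_add]
  · refine integral_congr_ae (.of_forall fun x => ?_)
    simp only [torusLaplacian_mFourier, freq_neg, norm_neg]
    push_cast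
    ring
  · exact (integrable_continuous_mul (mFourier (-k)).continuous (u t)).const_mul _
  · have := integrable_continuous_mul ((mFourier (-k)).continuous.mul
      (continuous_ofReal.comp hW)) (u t)
    refine this.congr (.of_forall fun x => ?_)
    simp [mul_assoc]

/-- The free evolution acts on Fourier coefficients by phases. -/
theorem IsSchrodingerSolution.mFourierCoeff_free (hu : IsSchrodingerSolution h (fun _ => 0) ψ u)
    (hh : 0 < h) (k : Fin 2 → ℤ) (t : ℝ) :
    mFourierCoeff (u t) k = exp (-(I * (h * ‖freq k‖ ^ 2 / 2 * t : ℝ))) * mFourierCoeff ψ k := by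
  set g : ℝ → ℂ := fun s => exp (I * (h * ‖freq k‖ ^ 2 / 2 * s : ℝ)) * mFourierCoeff (u s) k with hg
  have hd (s : ℝ) : HasDerivAt g 0 s := by
    have h1 := hu.hasDerivAt_mFourierCoeff continuous_const hh k s
    have h2 : HasDerivAt (fun s : ℝ => h * ‖freq k‖ ^ 2 / 2 * s) (h * ‖freq k‖ ^ 2 / 2) s := by
      simpa using (hasDerivAt_id s).const_mul (h * ‖freq k‖ ^ 2 / 2)
    convert! ((h2.ofReal_comp.const_mul I).cexp).mul h1 using 1
    have h3 : mFourierCoeff (fun x : Torus => ((0 : ℝ) : ℂ) * u s x) k = 0 := by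
      simp [mFourierCoeff_eq]
    rw [h3]
    have hh' : (h : ℂ) ≠ 0 := mod_cast hh.ne'
    generalize exp (I * (h * ‖freq k‖ ^ 2 / 2 * s : ℝ)) = E
    push_cast
    field_simp
    linear_combination (-(h ^ 2 * E * (‖freq k‖ : ℂ) ^ 2 * mFourierCoeff (u s) k)) * I_sq
  have hc := is_const_of_deriv_eq_zero (fun s => (hd s).differentiableAt) (fun s => (hd s).deriv) t 0
  simp only [hg, hu.initial, mul_zero, ofReal_zero, exp_zero, one_mul] at hc
  rw [← hc, ← mul_assoc, ← exp_add]
  simp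

/-- Conservation of the `L²` norm for weak solutions: the truncated norms
`∑_{k ∈ F} |û_k|²` have derivative `(2 / h) Im ∑_{k ∈ F} conj û_k (W u)^_k`, which tends to
`(2 / h) Im ⟨u, W u⟩ = 0`. -/
theorem IsSchrodingerSolution.norm_eq (hu : IsSchrodingerSolution h W ψ u)
    (hW : Continuous W) (hh : 0 < h) (t : ℝ) : ‖u t‖ = ‖ψ‖ := by
  obtain ⟨B, hB⟩ := isCompact_univ.exists_bound_of_continuousOn hW.continuousOn
  have hB0 : 0 ≤ B := (norm_nonneg _).trans (hB 0 (Set.mem_univ _))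
  let Wu : ℝ → L2 := fun s => (memLp_real_mul hW (u s)).toLp
  have hWu (s : ℝ) : (Wu s : Torus → ℂ) =ᵐ[torusMeasure] fun x => W x * u s x := MemLp.coeFn_toLp _
  have hWun (s : ℝ) : ‖Wu s‖ ≤ B * ‖u s‖ := by
    refine Lp.norm_le_mul_norm_of_ae_le_mul ?_
    filter_upwards [hWu s] with x hx
    rw [hx, norm_mul]
    gcongr
    simpa using hB x (Set.mem_univ x)
  set y : (Fin 2 → ℤ) → ℝ → ℂ := fun k s => mFourierCoeff (u s) k with hy
  set m : (Fin 2 → ℤ) → ℝ → ℂ := fun k s => mFourierCoeff (Wu s) k with hm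
  have hmW (k s) : m k s = mFourierCoeff (fun x => W x * u s x) k :=
    integral_congr_ae ((hWu s).mono fun x hx => by simp only [hx])
  have hyd (k s) : HasDerivAt (fun s => ‖y k s‖ ^ 2) (2 / h * (starRingEnd ℂ (y k s) * m k s).im) s := by
    have h1 := (hu.hasDerivAt_mFourierCoeff hW hh k s).norm_sq
    rw [← hmW] at h1
    convert h1 using 1
    rw [Complex.inner, mul_inv, inv_I]
    simp only [hy, mul_re, mul_im, conj_re, conj_im, add_re, add_im, ofReal_re, ofReal_im, neg_re,
      neg_im, I_re, I_im, ← ofReal_inv]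
    field_simp
    ring
  have hyc (k) : Continuous (y k) := continuous_iff_continuousAt.2 fun s =>
    (hu.hasDerivAt_mFourierCoeff hW hh k s).continuousAt
  have hmc (k) : Continuous (m k) := by
    let f : C(Torus, ℂ) := ⟨fun x => mFourier (-k) x * W x, by fun_prop⟩
    have e : m k = fun s => ⟪ContinuousMap.toLp 2 torusMeasure ℂ (star f), u s⟫_ℂ := by
      ext s
      rw [← integral_mul_eq_inner, hmW, mFourierCoeff_eq]
      exact integral_congr_ae (.of_forall fun x => by simp [f, mul_assoc])
    rw [e]
    exact continuous_const.inner hu.continuous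
  have hFTC (F : Finset (Fin 2 → ℤ)) : ∫ s in (0 : ℝ)..t,
      ∑ k ∈ F, 2 / h * (starRingEnd ℂ (y k s) * m k s).im =
      ∑ k ∈ F, ‖y k t‖ ^ 2 - ∑ k ∈ F, ‖y k 0‖ ^ 2 := by
    refine intervalIntegral.integral_eq_sub_of_hasDerivAt
      (f := fun s => ∑ k ∈ F, ‖y k s‖ ^ 2) (fun s _ => ?_) ?_
    · exact HasDerivAt.fun_sum fun k _ => hyd k s
    · exact Continuous.intervalIntegrable (by fun_prop) _ _
  -- Dominated convergence in time, with the Bessel bound for the truncated sums.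
  have hlim1 : Tendsto (fun F : Finset (Fin 2 → ℤ) => ∫ s in (0 : ℝ)..t,
      ∑ k ∈ F, 2 / h * (starRingEnd ℂ (y k s) * m k s).im) atTop (𝓝 (∫ _ in (0 : ℝ)..t, 0)) := by
    refine intervalIntegral.tendsto_integral_filter_of_dominated_convergence
      (fun s => 1 / h * (‖u s‖ ^ 2 + (B * ‖u s‖) ^ 2)) (.of_forall fun F => ?_)
      (.of_forall fun F => .of_forall fun s _ => ?_) ?_ (.of_forall fun s _ => ?_)
    · exact Continuous.aestronglyMeasurable (by fun_prop)
    · have h1 (k) : ‖2 / h * (starRingEnd ℂ (y k s) * m k s).im‖ ≤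
          1 / h * (‖y k s‖ ^ 2 + ‖m k s‖ ^ 2) := by
        rw [norm_mul, Real.norm_eq_abs, abs_of_pos (by positivity), div_mul_eq_mul_div,
          div_mul_eq_mul_div, div_le_div_iff_of_pos_right hh]
        have h2 : ‖(starRingEnd ℂ (y k s) * m k s).im‖ ≤ ‖y k s‖ * ‖m k s‖ := by
          refine (Complex.abs_im_le_norm _).trans_eq ?_
          rw [norm_mul, RCLike.norm_conj]
        nlinarith [sq_nonneg (‖y k s‖ - ‖m k s‖)]
      refine (norm_sum_le _ _).trans ((Finset.sum_le_sum fun k _ => h1 k).trans ?_)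
      rw [← Finset.mul_sum, Finset.sum_add_distrib]
      have h3 := sum_le_hasSum F (fun k _ => by positivity) (hasSum_norm_sq_mFourierCoeff (u s))
      have h4 := sum_le_hasSum F (fun k _ => by positivity) (hasSum_norm_sq_mFourierCoeff (Wu s))
      have h5 := pow_le_pow_left₀ (norm_nonneg _) (hWun s) 2
      gcongr
      exact h4.trans h5
    · have := hu.continuous
      exact Continuous.intervalIntegrable (by fun_prop) _ _
    · have h1 : HasSum (fun k => starRingEnd ℂ (y k s) * m k s)
          (∫ x, starRingEnd ℂ (u s x) * Wu s x ∂torusMeasure) := hasSum_prod_mFourierCoeff (u s) (Wu s)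
      have h2 : ∫ x, starRingEnd ℂ (u s x) * Wu s x ∂torusMeasure =
          ((∫ x, W x * ‖u s x‖ ^ 2 ∂torusMeasure : ℝ) : ℂ) := by
        rw [← integral_complex_ofReal]
        refine integral_congr_ae ?_
        filter_upwards [hWu s] with x hx
        rw [hx, mul_left_comm, ← Complex.normSq_eq_conj_mul_self, Complex.normSq_eq_norm_sq]
        simp
      rw [h2] at h1
      have h3 := (Complex.hasSum_im h1).mul_left (2 / h)
      rw [ofReal_im, mul_zero] at h3
      simpa only [HasSum, SummationFilter.unconditional_filter] using h3
  have hlim2 : Tendsto (fun F : Finset (Fin 2 → ℤ) =>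
      ∑ k ∈ F, ‖y k t‖ ^ 2 - ∑ k ∈ F, ‖y k 0‖ ^ 2) atTop (𝓝 (‖u t‖ ^ 2 - ‖u 0‖ ^ 2)) :=
    Tendsto.sub (by simpa only [HasSum, SummationFilter.unconditional_filter] using
        hasSum_norm_sq_mFourierCoeff (u t))
      (by simpa only [HasSum, SummationFilter.unconditional_filter] using
        hasSum_norm_sq_mFourierCoeff (u 0))
  simp only [hFTC] at hlim1
  have := tendsto_nhds_unique hlim1 hlim2
  rw [intervalIntegral.integral_zero, hu.initial] at this
  nlinarith [norm_nonneg (u t), norm_nonneg ψ,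
    sq_eq_sq₀ (norm_nonneg (u t)) (norm_nonneg ψ)|>.1 (by linarith)]

end Solutions

end

/-! ### Pairings of weak solutions with quantized symbols -/

section

theorem norm_integral_continuous_mul_le {f : Torus → ℂ} (hf : Continuous f) {B : ℝ} (hB0 : 0 ≤ B)
    (hB : ∀ x, ‖f x‖ ≤ B) (w : L2) : ‖∫ x, f x * w x ∂torusMeasure‖ ≤ B * ‖w‖ := by
  have := integral_mul_eq_inner ⟨f, hf⟩ w
  rw [ContinuousMap.coe_mk] at this
  rw [this]
  refine (norm_inner_le_norm _ _).trans ?_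
  gcongr
  refine (Lp.norm_le_of_ae_bound (C := B) hB0 ?_).trans_eq ?_
  · filter_upwards [ContinuousMap.coeFn_toLp (𝕜 := ℂ) (p := 2) torusMeasure
      (star (⟨f, hf⟩ : C(Torus, ℂ)))] with x hx
    rw [hx]
    simpa using hB x
  · simp [measureUnivNNReal]

theorem hasDerivAt_param {f : ℝ → Torus → ℂ}
    (hf : ContDiff ℝ ∞ fun p : ℝ × Plane => f p.1 (toTorus p.2)) (t : ℝ) (y : Plane) :
    HasDerivAt (fun t => f t (toTorus y))
      (dirDeriv ((1 : ℝ), (0 : Plane)) (fun p : ℝ × Plane => f p.1 (toTorus p.2)) (t, y)) t := by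
  simpa using hasDerivAt_line hf ((0 : ℝ), y) ((1 : ℝ), (0 : Plane)) t

theorem continuous_deriv_param {f : ℝ → Torus → ℂ}
    (hf : ContDiff ℝ ∞ fun p : ℝ × Plane => f p.1 (toTorus p.2)) :
    Continuous fun p : ℝ × Torus => deriv (fun t => f t p.2) p.1 := by
  have hq : IsOpenQuotientMap (Prod.map id toTorus : ℝ × Plane → ℝ × Torus) :=
    .prodMap .id isOpenQuotientMap_toTorus
  refine hq.isQuotientMap.continuous_iff.2 ?_
  refine (contDiff_dirDeriv hf ((1 : ℝ), (0 : Plane))).continuous.congr fun p => ?_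
  exact (hasDerivAt_param hf p.1 p.2).deriv.symm

/-- Product rule for the pairing of a smooth family of test functions with a curve in `L²` which is
continuous, but differentiable only against the fixed test function `f s`. -/
theorem hasDerivAt_integral_mul {f : ℝ → Torus → ℂ}
    (hf : ContDiff ℝ ∞ fun p : ℝ × Plane => f p.1 (toTorus p.2)) {w : ℝ → L2} (hw : Continuous w)
    {s : ℝ} {D : ℂ} (hD : HasDerivAt (fun t => ∫ x, f s x * w t x ∂torusMeasure) D s) :
    HasDerivAt (fun t => ∫ x, f t x * w t x ∂torusMeasure)
      (∫ x, deriv (fun t => f t x) s * w s x ∂torusMeasure + D) s := by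
  have hq : IsOpenQuotientMap (Prod.map id toTorus : ℝ × Plane → ℝ × Torus) :=
    .prodMap .id isOpenQuotientMap_toTorus
  have hd (t : ℝ) (x : Torus) : HasDerivAt (fun t => f t x) (deriv (fun t => f t x) t) t := by
    obtain ⟨y, rfl⟩ := isOpenQuotientMap_toTorus.surjective x
    exact (hasDerivAt_param hf t y).differentiableAt.hasDerivAt
  have hfc : Continuous fun p : ℝ × Torus => f p.1 p.2 :=
    hq.isQuotientMap.continuous_iff.2 hf.continuous
  have hdc := continuous_deriv_param hf
  have hft (t : ℝ) : Continuous (f t) := hfc.comp (by fun_prop : Continuous fun x : Torus => (t, x))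
  have hdt (t : ℝ) : Continuous fun x => deriv (fun t => f t x) t :=
    hdc.comp (by fun_prop : Continuous fun x : Torus => (t, x))
  obtain ⟨C, hC⟩ := ((isCompact_closedBall s 1).prod
    (isCompact_univ (X := Torus))).exists_bound_of_continuousOn hdc.continuousOn
  have hC' (t : ℝ) (ht : t ∈ Metric.closedBall s 1) (x : Torus) : ‖deriv (fun t => f t x) t‖ ≤ C :=
    hC (t, x) ⟨ht, Set.mem_univ _⟩
  have hC0 : 0 ≤ C := (norm_nonneg _).trans (hC' s (by simp) 0)
  have hwi (v : L2) : Integrable v torusMeasure := (Lp.memLp v).integrable one_le_two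
  have h1 : HasDerivAt (fun t => ∫ x, f t x * w s x ∂torusMeasure)
      (∫ x, deriv (fun t => f t x) s * w s x ∂torusMeasure) s := by
    refine (hasDerivAt_integral_of_dominated_loc_of_deriv_le (F := fun t x => f t x * w s x)
      (F' := fun t x => deriv (fun t => f t x) t * w s x) (bound := fun x => C * ‖w s x‖)
      (Metric.closedBall_mem_nhds s one_pos) (.of_forall fun t => ?_) ?_ ?_
      (.of_forall fun x t ht => ?_) ((hwi _).norm.const_mul C) (.of_forall fun x t _ => ?_)).2
    · exact (integrable_continuous_mul (hft t) _).aestronglyMeasurable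
    · exact integrable_continuous_mul (hft s) _
    · exact (integrable_continuous_mul (hdt s) _).aestronglyMeasurable
    · rw [norm_mul]
      gcongr
      exact hC' t ht x
    · exact (hd t x).mul_const _
  -- The increments of both factors are `O(t - s)` and `o(1)`: only norm continuity of `w` is needed.
  have h3 : HasDerivAt (fun t => ∫ x, (f t x - f s x) * (w t - w s) x ∂torusMeasure) 0 s := by
    have hbd : ∀ᶠ t in 𝓝 s, ‖∫ x, (f t x - f s x) * (w t - w s) x ∂torusMeasure‖ ≤
        C * ‖t - s‖ * ‖w t - w s‖ := by
      filter_upwards [Metric.closedBall_mem_nhds s one_pos] with t ht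
      refine norm_integral_continuous_mul_le ((hft t).sub (hft s)) (by positivity) (fun x => ?_) _
      exact (convex_closedBall s 1).norm_image_sub_le_of_norm_hasDerivWithin_le
        (fun r _ => (hd r x).hasDerivWithinAt) (fun r hr => hC' r hr x) (by simp) ht
    rw [hasDerivAt_iff_isLittleO]
    simp only [sub_self, smul_zero, zero_mul, integral_zero, sub_zero]
    have hlim : Tendsto (fun t => C * ‖w t - w s‖) (𝓝 s) (𝓝 0) := by
      have : Continuous fun t => C * ‖w t - w s‖ := by fun_prop
      simpa using this.tendsto s
    refine Asymptotics.isLittleO_iff.2 fun c hc => ?_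
    filter_upwards [hbd, hlim.eventually (gt_mem_nhds hc)] with t h4 h5
    nlinarith [norm_nonneg (t - s)]
  have h4 := (h1.add (hD.add h3)).sub_const (∫ x, f s x * w s x ∂torusMeasure)
  rw [add_zero] at h4
  refine h4.congr_of_eventuallyEq (.of_forall fun t => ?_)
  have i1 := integrable_continuous_mul (hft t) (w s)
  have i2 := integrable_continuous_mul (hft s) (w t)
  have i3 : Integrable (fun x => (f t x - f s x) * (w t - w s) x) torusMeasure :=
    integrable_continuous_mul ((hft t).sub (hft s)) (w t - w s)
  have i4 := integrable_continuous_mul (hft s) (w s)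
  simp only [Pi.add_apply]
  have i5 : Integrable (fun x => f s x * w t x + (f t x - f s x) * (w t - w s) x) torusMeasure :=
    i2.add i3
  have i6 : Integrable (fun x => f t x * w s x + (f s x * w t x + (f t x - f s x) *
    (w t - w s) x)) torusMeasure := i1.add i5
  rw [← integral_add i2 i3, ← integral_add i1 i5, ← integral_sub i6 i4]
  refine integral_congr_ae ?_
  filter_upwards [Lp.coeFn_sub (w t) (w s)] with x hx
  rw [hx, Pi.sub_apply]
  ring

/-- The residual of a family of symbols in the transport equation
`∂_s α + τ ξ · ∇α - i V α + (i τ h / 2) Δα = 0`. -/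
noncomputable def residual (V : Torus → ℝ) (τ h : ℝ) (α : ℝ → Phase → ℂ) (s : ℝ) (p : Phase) : ℂ :=
  deriv (fun s => α s p) s + τ * torusDeriv (fun q => α s (q, p.2)) p.1 p.2 - I * V p.1 * α s p +
    I * (τ * h / 2 : ℝ) * torusLaplacian (fun q => α s (q, p.2)) p.1

theorem torusDeriv_smul (f : Torus → ℂ) (x : Torus) (c : ℝ) (v : Plane) :
    torusDeriv f x (c • v) = c * torusDeriv f x v := by
  simp [torusDeriv, dirDeriv]

theorem torusDeriv_neg (f : Torus → ℂ) (x : Torus) (v : Plane) :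
    torusDeriv f x (-v) = -torusDeriv f x v := by
  simp [torusDeriv, dirDeriv]

theorem torusLaplacian_mul_const {f : Torus → ℂ} (hf : TorusSmooth f) (c : ℂ) (x : Torus) :
    torusLaplacian (fun x => f x * c) x = torusLaplacian f x * c := by
  have hA := hf.contDiff_add x
  have e (g : Plane → ℂ) (hg : ContDiff ℝ ∞ g) (v : Plane) :
      dirDeriv v (fun y => g y * c) = fun y => dirDeriv v g y * c := by
    rw [dirDeriv_mul hg contDiff_const, dirDeriv_const]
    simp
  rw [torusLaplacian, torusLaplacian, laplacian_eq_sum_dirDeriv (hA.mul contDiff_const),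
    laplacian_eq_sum_dirDeriv hA, Finset.sum_mul]
  refine Finset.sum_congr rfl fun i _ => ?_
  rw [e _ hA, e _ (contDiff_dirDeriv hA _)]

theorem TorusSmooth.torusLaplacian {f : Torus → ℂ} (hf : TorusSmooth f) :
    TorusSmooth (torusLaplacian f) := by
  have hf' : ContDiff ℝ ∞ fun y : Plane => f (toTorus y) := hf
  have e (x : Plane) : Loschmidt.torusLaplacian f (toTorus x) =
      ∑ i, dirDeriv (EuclideanSpace.basisFun (Fin 2) ℝ i)
        (dirDeriv (EuclideanSpace.basisFun (Fin 2) ℝ i) fun y : Plane => f (toTorus y)) x := by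
    have h1 := hf.contDiff_add (toTorus x)
    have h2 (g : Plane → ℂ) (hg : ContDiff ℝ ∞ g) (v : Plane) :
        dirDeriv v (fun y => g (x + y)) = fun y => dirDeriv v g (x + y) :=
      dirDeriv_comp (ContinuousLinearMap.id ℝ Plane) hg x v
    rw [Loschmidt.torusLaplacian, laplacian_eq_sum_dirDeriv h1]
    refine Finset.sum_congr rfl fun i _ => ?_
    simp only [← toTorus_add]
    rw [h2 _ hf', h2 _ (contDiff_dirDeriv hf' _)]
    simp only [add_zero]
  unfold TorusSmooth
  simp only [e]
  exact ContDiff.sum fun i _ => contDiff_dirDeriv (contDiff_dirDeriv hf' _) _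

variable {α : ℝ → Phase → ℂ} {V : Torus → ℝ} {h ε : ℝ} {ψ : L2} {u : ℝ → L2}

theorem IsSymbolFamily.torusSmooth (hα : IsSymbolFamily α) (s : ℝ) (ξ : Plane) :
    TorusSmooth fun x => α s (x, ξ) := by
  have := hα.smooth.comp
    (contDiff_const.prodMk (contDiff_id.prodMk contDiff_const) :
      ContDiff ℝ ∞ fun y : Plane => (s, y, ξ))
  exact this

/-- The evolution of the pairing of the perturbed solution with one mode of the quantized family of
symbols. The free phase absorbs the main part of the Laplacian, and `τ = h / ε` turns the potential
into a term of order one. -/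
theorem hasDerivAt_mode (hα : IsSymbolFamily α) (hV : TorusSmooth V)
    (hu : IsSchrodingerSolution h (fun x => ε * V x) ψ u) (hh : 0 < h) (hε : 0 < ε)
    (k : Fin 2 → ℤ) (s : ℝ) :
    HasDerivAt (fun s => ∫ x, (α s (x, h • freq k) * mFourier (-k) x *
        exp (I * (h / ε * h * ‖freq k‖ ^ 2 / 2 * s : ℝ))) * u (s * (h / ε)) x ∂torusMeasure)
      (∫ x, (residual V (h / ε) h α s (x, h • freq k) * mFourier (-k) x *
        exp (I * (h / ε * h * ‖freq k‖ ^ 2 / 2 * s : ℝ))) * u (s * (h / ε)) x ∂torusMeasure) s := by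
  have hh' : (h : ℂ) ≠ 0 := mod_cast hh.ne'
  have hε' : (ε : ℂ) ≠ 0 := mod_cast hε.ne'
  set θ : ℝ := h / ε * h * ‖freq k‖ ^ 2 / 2 with hθ
  set f : ℝ → Torus → ℂ := fun s x => α s (x, h • freq k) * mFourier (-k) x *
    exp (I * (θ * s : ℝ)) with hf
  have hsm : ContDiff ℝ ∞ fun p : ℝ × Plane => f p.1 (toTorus p.2) := by
    have h1 : ContDiff ℝ ∞ fun p : ℝ × Plane => α p.1 (toTorus p.2, h • freq k) :=
      hα.smooth.comp (contDiff_fst.prodMk (contDiff_snd.prodMk contDiff_const))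
    have h2 : ContDiff ℝ ∞ fun p : ℝ × Plane => mFourier (-k) (toTorus p.2) :=
      ContDiff.comp (g := fun y : Plane => mFourier (-k) (toTorus y)) (torusSmooth_mFourier (-k))
        contDiff_snd
    have h3 : ContDiff ℝ ∞ fun p : ℝ × Plane => exp (I * (θ * p.1 : ℝ)) :=
      (contDiff_const.mul (Complex.ofRealCLM.contDiff.comp (contDiff_const.mul contDiff_fst))).cexp
    exact (h1.mul h2).mul h3
  have hfs : TorusSmooth (f s) := hsm.comp (contDiff_const.prodMk contDiff_id)
  have hD : HasDerivAt (fun t => ∫ x, f s x * u (t * (h / ε)) x ∂torusMeasure)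
      ((h / ε : ℝ) * ((I * h)⁻¹ * ∫ x, (-(h ^ 2 / 2 : ℝ) * torusLaplacian (f s) x +
        (ε * V x : ℝ) * f s x) * u (s * (h / ε)) x ∂torusMeasure)) s := by
    have h1 := (hu.equation (f s) hfs (s * (h / ε))).const_mul (I * h : ℂ)⁻¹
    simp only [inv_mul_cancel_left₀ (mul_ne_zero I_ne_zero hh')] at h1
    have h2 : HasDerivAt (fun t : ℝ => t * (h / ε)) (h / ε) s := by
      simpa using (hasDerivAt_id s).mul_const (h / ε)
    have h3 := h1.scomp s h2
    simpa only [real_smul] using! h3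
  have hmain := hasDerivAt_integral_mul hsm (w := fun t => u (t * (h / ε)))
    (hu.continuous.comp (by fun_prop)) hD
  convert! hmain using 1
  rw [← integral_const_mul, ← integral_const_mul, ← integral_add]
  · refine integral_congr_ae (.of_forall fun x => ?_)
    have hds : HasDerivAt (fun t => f t x) (deriv (fun s => α s (x, h • freq k)) s *
        mFourier (-k) x * exp (I * (θ * s : ℝ)) + α s (x, h • freq k) * mFourier (-k) x *
          (exp (I * (θ * s : ℝ)) * (I * θ))) s := by
      have h1 : HasDerivAt (fun s => α s (x, h • freq k)) (deriv (fun s => α s (x, h • freq k)) s)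
          s := by
        obtain ⟨y, rfl⟩ := isOpenQuotientMap_toTorus.surjective x
        have : ContDiff ℝ ∞ fun s : ℝ => α s (toTorus y, h • freq k) :=
          hα.smooth.comp (contDiff_id.prodMk (contDiff_const (c := (y, h • freq k))))
        exact (this.differentiable (by simp) s).hasDerivAt
      have h2 : HasDerivAt (fun s : ℝ => θ * s) θ s := by
        simpa using (hasDerivAt_id s).const_mul θ
      exact (h1.mul_const _).mul ((h2.ofReal_comp.const_mul I).cexp)
    have hlap : torusLaplacian (f s) x = (torusLaplacian (fun q => α s (q, h • freq k)) x -
        2 * I * torusDeriv (fun q => α s (q, h • freq k)) x (freq k) -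
          (‖freq k‖ ^ 2 : ℝ) * α s (x, h • freq k)) * mFourier (-k) x * exp (I * (θ * s : ℝ)) := by
      have hs1 := hα.torusSmooth s (h • freq k)
      have hs2 : TorusSmooth fun x => α s (x, h • freq k) * mFourier (-k) x :=
        ContDiff.mul hs1 (torusSmooth_mFourier (-k))
      rw [hf, torusLaplacian_mul_const hs2, torusLaplacian_mul_mFourier hs1, freq_neg, norm_neg,
        torusDeriv_neg]
      ring
    simp only [residual, torusDeriv_smul]
    rw [hds.deriv, hlap]
    simp only [hf, hθ]
    generalize exp (I * (h / ε * h * ‖freq k‖ ^ 2 / 2 * s : ℝ)) = E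
    push_cast
    field_simp
    ring_nf
    simp only [I_sq]
    ring_nf
  · exact integrable_continuous_mul ((continuous_deriv_param hsm).comp
      (by fun_prop : Continuous fun x : Torus => (s, x))) _
  · refine Integrable.const_mul (Integrable.const_mul (integrable_continuous_mul ?_ _) _) _
    have h1 : Continuous (torusLaplacian (f s)) := hfs.torusLaplacian.continuous
    have h2 := hV.continuous
    have h3 := hfs.continuous
    fun_prop

/-- Derivatives in the position variable are directional derivatives of the lift, as a function of
`(s, x, ξ)`; they therefore depend smoothly on all variables. -/
theorem IsSymbolFamily.torusDeriv_eq (hα : IsSymbolFamily α) (s : ℝ) (x ξ v : Plane) :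
    torusDeriv (fun q => α s (q, ξ)) (toTorus x) v = dirDeriv ((0 : ℝ), v, (0 : Plane))
      (fun p : ℝ × Plane × Plane => α p.1 (toTorus p.2.1, p.2.2)) (s, x, ξ) := by
  have h := dirDeriv_comp ((ContinuousLinearMap.inr ℝ ℝ (Plane × Plane)).comp
    (ContinuousLinearMap.inl ℝ Plane Plane)) hα.smooth (s, x, ξ) v
  have := congrFun h 0
  simpa [torusDeriv, toTorus_add] using this

theorem IsSymbolFamily.torusLaplacian_eq (hα : IsSymbolFamily α) (s : ℝ) (x ξ : Plane) :
    torusLaplacian (fun q => α s (q, ξ)) (toTorus x) =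
      ∑ i, dirDeriv ((0 : ℝ), EuclideanSpace.basisFun (Fin 2) ℝ i, (0 : Plane))
        (dirDeriv ((0 : ℝ), EuclideanSpace.basisFun (Fin 2) ℝ i, (0 : Plane))
          fun p : ℝ × Plane × Plane => α p.1 (toTorus p.2.1, p.2.2)) (s, x, ξ) := by
  have h1 := (hα.torusSmooth s ξ).contDiff_add (toTorus x)
  set L := (ContinuousLinearMap.inr ℝ ℝ (Plane × Plane)).comp
    (ContinuousLinearMap.inl ℝ Plane Plane) with hL
  have h2 (g : ℝ × Plane × Plane → ℂ) (hg : ContDiff ℝ ∞ g) (v : Plane) :=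
    dirDeriv_comp L hg (s, x, ξ) v
  rw [torusLaplacian, laplacian_eq_sum_dirDeriv h1]
  refine Finset.sum_congr rfl fun i _ => ?_
  have e : (fun y : Plane => α s (toTorus x + toTorus y, ξ)) = fun y =>
      (fun p : ℝ × Plane × Plane => α p.1 (toTorus p.2.1, p.2.2)) ((s, x, ξ) + L y) := by
    ext y; simp [hL, toTorus_add]
  rw [e, h2 _ hα.smooth, h2 _ (contDiff_dirDeriv hα.smooth _)]
  simp [hL]

theorem IsSymbolFamily.laplacian (hα : IsSymbolFamily α) :
    IsSymbolFamily fun s p => torusLaplacian (fun q => α s (q, p.2)) p.1 := by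
  constructor
  · simp only [hα.torusLaplacian_eq]
    exact ContDiff.sum fun i _ => contDiff_dirDeriv (contDiff_dirDeriv hα.smooth _) _
  · obtain ⟨R, hR⟩ := hα.compactSupport
    refine ⟨R, fun s p hp => ?_⟩
    have (q : Torus) : α s (q, p.2) = 0 := hR s (q, p.2) hp
    simp only [this, torusLaplacian]
    rw [laplacian_eq_sum_dirDeriv contDiff_const]
    simp [dirDeriv_const]

theorem IsSymbolFamily.deriv_self (hα : IsSymbolFamily α) :
    IsSymbolFamily fun s p => torusDeriv (fun q => α s (q, p.2)) p.1 p.2 := by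
  constructor
  · simp only [hα.torusDeriv_eq]
    exact (hα.smooth.fderiv_right (m := ∞) (by simp)).clm_apply
      (contDiff_const.prodMk (contDiff_snd.snd.prodMk contDiff_const))
  · obtain ⟨R, hR⟩ := hα.compactSupport
    refine ⟨R, fun s p hp => ?_⟩
    have (q : Torus) : α s (q, p.2) = 0 := hR s (q, p.2) hp
    simp only [this, torusDeriv, dirDeriv_const]

theorem IsSymbolFamily.conj (hα : IsSymbolFamily α) :
    IsSymbolFamily fun s p => starRingEnd ℂ (α s p) := by
  refine ⟨Complex.conjCLE.contDiff.comp hα.smooth, ?_⟩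
  obtain ⟨R, hR⟩ := hα.compactSupport
  exact ⟨R, fun s p hp => by rw [hR s p hp, map_zero]⟩

/-- The `L²` bound for the quantization, uniform in `h` and locally uniform in the parameter, for
pairings with `conj Op_h(conj α_s)`. -/
theorem IsSymbolFamily.exists_norm_sum_le (hα : IsSymbolFamily α) (T : ℝ) :
    ∃ M : ℝ, 0 ≤ M ∧ ∀ s, |s| ≤ T → ∀ h : ℝ, 0 < h → ∀ (w : L2) (K : Finset (Fin 2 → ℤ))
      (c : (Fin 2 → ℤ) → ℂ), ‖∑ k ∈ K, c k * ∫ x, α s (x, h • freq k) * mFourier (-k) x * w x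
        ∂torusMeasure‖ ≤ M * (‖w‖ * √(∑ k ∈ K, ‖c k‖ ^ 2)) := by
  obtain ⟨C, hC0, hC⟩ := hα.conj.exists_norm_fourierInv_le T
  refine ⟨C * decayIntegral, mul_nonneg hC0 decayIntegral_nonneg, fun s hs h hh w K c => ?_⟩
  have hc := (hα.conj.isTestSymbol s).continuous
  have hd : HasDecay C fun p => starRingEnd ℂ (α s p) := hC s hs
  have := norm_integral_conj_mul_sum_le (hα.conj.isTestSymbol s) hC0 hd hh w K
    fun k => starRingEnd ℂ (c k)
  simp only [RCLike.norm_conj] at this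
  have e (x : Torus) : starRingEnd ℂ (w x) * ∑ k ∈ K, starRingEnd ℂ (c k) *
      (starRingEnd ℂ (α s (x, h • freq k)) * mFourier k x) =
      starRingEnd ℂ (∑ k ∈ K, c k * (α s (x, h • freq k) * mFourier (-k) x * w x)) := by
    rw [map_sum, Finset.mul_sum]
    refine Finset.sum_congr rfl fun k _ => ?_
    rw [mFourier_neg]
    simp only [map_mul, Complex.conj_conj]
    ring
  simp only [e, integral_conj, RCLike.norm_conj] at this
  rw [integral_finsetSum] at this
  · simpa only [integral_const_mul] using this
  · intro k _
    have hα' := (hα.torusSmooth s (h • freq k)).continuous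
    exact (integrable_continuous_mul (hα'.mul (mFourier (-k)).continuous) w).const_mul _

end

/-! ### Energy truncation and the approximately conserved pairing -/

section

theorem mFourierCoeff_eq_inner (w : L2) (k : Fin 2 → ℤ) :
    mFourierCoeff w k = ⟪ContinuousMap.toLp 2 torusMeasure ℂ (mFourier k), w⟫_ℂ := by
  rw [mFourierCoeff_eq, integral_mul_eq_inner]
  congr 2
  ext x
  simp [mFourier_neg]

theorem inner_mFourier (j k : Fin 2 → ℤ) :
    ⟪ContinuousMap.toLp 2 torusMeasure ℂ (mFourier j),
      ContinuousMap.toLp 2 torusMeasure ℂ (mFourier k)⟫_ℂ = if j = k then 1 else 0 :=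
  orthonormal_iff_ite.1 orthonormal_mFourier j k

theorem mFourierCoeff_trigPoly (K : Finset (Fin 2 → ℤ)) (c : (Fin 2 → ℤ) → ℂ) (k : Fin 2 → ℤ) :
    mFourierCoeff (ContinuousMap.toLp 2 torusMeasure ℂ (trigPoly K c)) k =
      if k ∈ K then c k else 0 := by
  rw [mFourierCoeff_eq_inner, trigPoly, map_sum, inner_sum]
  simp [inner_smul_right, inner_mFourier]

theorem inner_trigPoly (K : Finset (Fin 2 → ℤ)) (c : (Fin 2 → ℤ) → ℂ) (w : L2) :
    ⟪ContinuousMap.toLp 2 torusMeasure ℂ (trigPoly K c), w⟫_ℂ =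
      ∑ k ∈ K, starRingEnd ℂ (c k) * mFourierCoeff w k := by
  rw [trigPoly, map_sum, sum_inner]
  simp [inner_smul_left, mFourierCoeff_eq_inner]

open Classical in
theorem mFourierCoeff_spectralProj (h : ℝ) (J : Set ℝ) (ψ : L2) (k : Fin 2 → ℤ) :
    mFourierCoeff (spectralProj h J ψ) k =
      if 4 * Real.pi ^ 2 * h ^ 2 * ∑ i, (k i : ℝ) ^ 2 ∈ J then mFourierCoeff ψ k else 0 := by
  have h1 : HasSum (fun k => mFourierCoeff ψ k • ContinuousMap.toLp 2 torusMeasure ℂ (mFourier k)) ψ :=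
    hasSum_mFourier_series_L2 ψ
  have h2 : Summable fun k : Fin 2 → ℤ =>
      if 4 * Real.pi ^ 2 * h ^ 2 * ∑ i, (k i : ℝ) ^ 2 ∈ J then
        mFourierCoeff ψ k • ContinuousMap.toLp 2 torusMeasure ℂ (mFourier k) else 0 := by
    refine (h1.summable.indicator
      {k : Fin 2 → ℤ | 4 * Real.pi ^ 2 * h ^ 2 * ∑ i, (k i : ℝ) ^ 2 ∈ J}).congr fun k => ?_
    simp [Set.indicator_apply]
  have h3 := (innerSL ℂ (ContinuousMap.toLp 2 torusMeasure ℂ (mFourier k))).hasSum h2.hasSum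
  rw [mFourierCoeff_eq_inner, spectralProj]
  refine (h3.unique (hasSum_single k fun j hj => ?_)).trans ?_
  · simp [apply_ite, inner_mFourier, hj.symm]
  · split_ifs
    · rw [innerSL_apply_apply, inner_smul_right, inner_mFourier, if_pos rfl, mul_one]
    · rw [map_zero]

open Classical in
theorem hasSum_spectralProj (h : ℝ) (J : Set ℝ) (ψ : L2) :
    HasSum (fun k : Fin 2 → ℤ => if 4 * Real.pi ^ 2 * h ^ 2 * ∑ i, (k i : ℝ) ^ 2 ∈ J then
      ‖mFourierCoeff ψ k‖ ^ 2 else 0) (‖spectralProj h J ψ‖ ^ 2) := by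
  refine (hasSum_norm_sq_mFourierCoeff (spectralProj h J ψ)).congr_fun fun k => ?_
  rw [mFourierCoeff_spectralProj]
  split_ifs <;> simp

theorem norm_spectralProj_le (h : ℝ) (J : Set ℝ) (ψ : L2) : ‖spectralProj h J ψ‖ ≤ ‖ψ‖ := by
  refine (sq_le_sq₀ (norm_nonneg _) (norm_nonneg _)).1 ?_
  refine hasSum_le (fun k => ?_) (hasSum_spectralProj h J ψ) (hasSum_norm_sq_mFourierCoeff ψ)
  split_ifs
  · rfl
  · positivity

/-- A smooth cutoff, equal to `1` for `|ξ|² ≤ R` and to `0` for `|ξ|² ≥ R + 1`. -/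
noncomputable def cutoff (R : ℝ) (ξ : Plane) : ℝ := Real.smoothTransition (R + 1 - ‖ξ‖ ^ 2)

theorem contDiff_cutoff (R : ℝ) : ContDiff ℝ ∞ (cutoff R) :=
  Real.smoothTransition.contDiff.comp (contDiff_const.sub (contDiff_norm_sq ℝ))

theorem cutoff_eq_one {R : ℝ} {ξ : Plane} (hξ : ‖ξ‖ ^ 2 ≤ R) : cutoff R ξ = 1 :=
  Real.smoothTransition.one_of_one_le (by linarith)

theorem cutoff_eq_zero {R : ℝ} {ξ : Plane} (hξ : R + 1 ≤ ‖ξ‖ ^ 2) : cutoff R ξ = 0 :=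
  Real.smoothTransition.zero_of_nonpos (by linarith)

theorem cutoff_nonneg (R : ℝ) (ξ : Plane) : 0 ≤ cutoff R ξ := Real.smoothTransition.nonneg _

theorem cutoff_le_one (R : ℝ) (ξ : Plane) : cutoff R ξ ≤ 1 := Real.smoothTransition.le_one _

theorem finite_freq {h : ℝ} (hh : 0 < h) (R : ℝ) :
    {k : Fin 2 → ℤ | ‖h • freq k‖ ^ 2 < R + 1}.Finite := by
  have hpi := Real.pi_pos
  obtain ⟨N, hN⟩ := exists_nat_gt ((R + 1) / (h ^ 2 * (4 * Real.pi ^ 2)))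
  refine (Set.finite_Icc (fun _ => -(N : ℤ)) fun _ => (N : ℤ)).subset fun k hk => ?_
  rw [Set.mem_ofPred_eq, norm_smul, mul_pow, norm_freq_sq, Real.norm_eq_abs, sq_abs, ← mul_assoc,
    ← lt_div_iff₀' (by positivity), Fin.sum_univ_two] at hk
  have h1 : (k 0 : ℝ) ^ 2 + (k 1 : ℝ) ^ 2 < N := hk.trans hN
  have h2 : k 0 ^ 2 + k 1 ^ 2 < N := by exact_mod_cast h1
  rw [Set.mem_Icc, Pi.le_def, Pi.le_def]
  simp only [Fin.forall_fin_two]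
  refine ⟨⟨?_, ?_⟩, ?_, ?_⟩ <;> nlinarith [sq_nonneg (k 0), sq_nonneg (k 1)]

variable {V : Torus → ℝ} {h ε : ℝ} {ψ : L2} {u uε : ℝ → L2}

/-- The free solution is approximated by its truncation to frequencies `|ξ|² ≤ R`, with an error
controlled by the spectral projector on high energies. -/
theorem norm_inner_free_sub_le (hu : IsSchrodingerSolution h (fun _ => 0) ψ u) (hh : 0 < h)
    (R t : ℝ) (K : Finset (Fin 2 → ℤ)) (hK : ∀ k ∉ K, cutoff R (h • freq k) = 0) (w : L2) :
    ‖⟪u t, w⟫_ℂ - ∑ k ∈ K, starRingEnd ℂ (mFourierCoeff ψ k) * (cutoff R (h • freq k) *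
      exp (I * (h * ‖freq k‖ ^ 2 / 2 * t : ℝ)) * mFourierCoeff w k)‖ ≤
    ‖spectralProj h (Set.Ici R) ψ‖ * ‖w‖ := by
  classical
  set c : (Fin 2 → ℤ) → ℂ := fun k => cutoff R (h • freq k) * mFourierCoeff (u t) k with hc
  set v := ContinuousMap.toLp 2 torusMeasure ℂ (trigPoly K c) with hv
  have e : ⟪v, w⟫_ℂ = ∑ k ∈ K, starRingEnd ℂ (mFourierCoeff ψ k) * (cutoff R (h • freq k) *
      exp (I * (h * ‖freq k‖ ^ 2 / 2 * t : ℝ)) * mFourierCoeff w k) := by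
    rw [hv, inner_trigPoly]
    refine Finset.sum_congr rfl fun k _ => ?_
    simp only [hc, hu.mFourierCoeff_free hh, map_mul, ← exp_conj, map_neg, conj_ofReal, conj_I]
    rw [neg_mul, neg_neg]
    ring
  rw [← e, ← inner_sub_left]
  refine (norm_inner_le_norm _ _).trans ?_
  gcongr
  refine (sq_le_sq₀ (norm_nonneg _) (norm_nonneg _)).1 ?_
  refine hasSum_le (fun k => ?_) (hasSum_norm_sq_mFourierCoeff (u t - v))
    (hasSum_spectralProj h (Set.Ici R) ψ)
  have e1 : mFourierCoeff (u t - v : L2) k =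
      (1 - cutoff R (h • freq k) : ℝ) * mFourierCoeff (u t) k := by
    rw [mFourierCoeff_eq_inner, inner_sub_right, ← mFourierCoeff_eq_inner, ← mFourierCoeff_eq_inner,
      hv, mFourierCoeff_trigPoly]
    split_ifs with hk
    · simp only [hc]; push_cast; ring
    · rw [hK k hk]; simp
  have e2 : ‖mFourierCoeff (u t) k‖ = ‖mFourierCoeff ψ k‖ := by
    rw [hu.mFourierCoeff_free hh, norm_mul, ← mul_neg, ← ofReal_neg, mul_comm I,
      norm_exp_ofReal_mul_I, one_mul]
  have e3 : 4 * Real.pi ^ 2 * h ^ 2 * ∑ i, (k i : ℝ) ^ 2 = ‖h • freq k‖ ^ 2 := by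
    rw [norm_smul, mul_pow, norm_freq_sq, Real.norm_eq_abs, sq_abs]
    ring
  have h0 := cutoff_nonneg R (h • freq k)
  have h1 := cutoff_le_one R (h • freq k)
  rw [e1, e3, norm_mul, e2, Complex.norm_real, Real.norm_eq_abs, abs_of_nonneg (by linarith), mul_pow]
  split_ifs with hR
  · refine mul_le_of_le_one_left (by positivity) ?_
    nlinarith
  · rw [cutoff_eq_one (not_le.1 hR).le]
    simp

theorem sum_norm_sq_mFourierCoeff_le (ψ : L2) (K : Finset (Fin 2 → ℤ)) :
    √(∑ k ∈ K, ‖mFourierCoeff ψ k‖ ^ 2) ≤ ‖ψ‖ := by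
  rw [Real.sqrt_le_left (norm_nonneg _)]
  exact sum_le_hasSum K (fun k _ => by positivity) (hasSum_norm_sq_mFourierCoeff ψ)

/-- The pairing `⟨Op_h(conj α_s) u(sτ), w⟩`, `τ = h / ε`, for the free solution `u` with initial datum
`ψ` truncated to the modes in `K`. The free phase is written out, so that only `ψ` enters. -/
noncomputable def pairing (h ε : ℝ) (ψ : L2) (α : ℝ → Phase → ℂ) (K : Finset (Fin 2 → ℤ)) (w : L2)
    (s : ℝ) : ℂ :=
  ∑ k ∈ K, starRingEnd ℂ (mFourierCoeff ψ k) * ∫ x, (α s (x, h • freq k) * mFourier (-k) x *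
    exp (I * (h / ε * h * ‖freq k‖ ^ 2 / 2 * s : ℝ))) * w x ∂torusMeasure

theorem pairing_eq (h ε : ℝ) (ψ : L2) (α : ℝ → Phase → ℂ) (K : Finset (Fin 2 → ℤ)) (w : L2)
    (s : ℝ) : pairing h ε ψ α K w s = ∑ k ∈ K, (starRingEnd ℂ (mFourierCoeff ψ k) *
      exp (I * (h / ε * h * ‖freq k‖ ^ 2 / 2 * s : ℝ))) *
      ∫ x, α s (x, h • freq k) * mFourier (-k) x * w x ∂torusMeasure := by
  refine Finset.sum_congr rfl fun k _ => ?_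
  rw [mul_assoc (starRingEnd ℂ _) (exp _), ← integral_const_mul (exp _)]
  refine congrArg _ (integral_congr_ae (.of_forall fun x => ?_))
  ring

/-- A family of symbols with small residual gives an approximately conserved pairing. -/
theorem norm_pairing_sub_le {α r₁ r₂ : ℝ → Phase → ℂ} (hα : IsSymbolFamily α)
    (hr₁ : IsSymbolFamily r₁) (hr₂ : IsSymbolFamily r₂) (hV : TorusSmooth V) (T : ℝ) :
    ∃ M : ℝ, ∀ (h ε : ℝ) (l₁ l₂ : ℂ) (ψ : L2) (uε : ℝ → L2),
      IsSchrodingerSolution h (fun x => ε * V x) ψ uε → 0 < h → 0 < ε →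
      (∀ s p, residual V (h / ε) h α s p = l₁ * r₁ s p + l₂ * r₂ s p) →
      ∀ K : Finset (Fin 2 → ℤ),
        ‖pairing h ε ψ α K (uε (T * (h / ε))) T - pairing h ε ψ α K ψ 0‖ ≤
          M * (‖l₁‖ + ‖l₂‖) * ‖ψ‖ ^ 2 := by
  obtain ⟨M₁, hM₁0, hM₁⟩ := hr₁.exists_norm_sum_le |T|
  obtain ⟨M₂, hM₂0, hM₂⟩ := hr₂.exists_norm_sum_le |T|
  refine ⟨max M₁ M₂ * |T|, fun h ε l₁ l₂ ψ uε hu hh hε hres K => ?_⟩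
  have hW : Continuous fun x => ε * V x := continuous_const.mul hV.continuous
  have hd (s : ℝ) : HasDerivAt (fun s => pairing h ε ψ α K (uε (s * (h / ε))) s)
      (pairing h ε ψ (residual V (h / ε) h α) K (uε (s * (h / ε))) s) s :=
    HasDerivAt.fun_sum fun k _ => (hasDerivAt_mode hα hV hu hh hε k s).const_mul _
  have hsplit (w : L2) (s : ℝ) : pairing h ε ψ (residual V (h / ε) h α) K w s =
      l₁ * pairing h ε ψ r₁ K w s + l₂ * pairing h ε ψ r₂ K w s := by
    simp only [pairing_eq, Finset.mul_sum, ← Finset.sum_add_distrib]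
    refine Finset.sum_congr rfl fun k _ => ?_
    have i (r : ℝ → Phase → ℂ) (hr : IsSymbolFamily r) (l : ℂ) : Integrable (fun x =>
        l * (r s (x, h • freq k) * mFourier (-k) x * w x)) torusMeasure :=
      (integrable_continuous_mul ((hr.torusSmooth s _).continuous.mul
        (mFourier (-k)).continuous) w).const_mul _
    have e : ∫ x, residual V (h / ε) h α s (x, h • freq k) * mFourier (-k) x * w x ∂torusMeasure =
        l₁ * ∫ x, r₁ s (x, h • freq k) * mFourier (-k) x * w x ∂torusMeasure +
        l₂ * ∫ x, r₂ s (x, h • freq k) * mFourier (-k) x * w x ∂torusMeasure := by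
      rw [← integral_const_mul, ← integral_const_mul, ← integral_add (i r₁ hr₁ l₁) (i r₂ hr₂ l₂)]
      refine integral_congr_ae (.of_forall fun x => ?_)
      simp only [hres]
      ring
    rw [e]
    ring
  have hbd {r : ℝ → Phase → ℂ} {M : ℝ} (hM0 : 0 ≤ M)
      (hM : ∀ s, |s| ≤ |T| → ∀ h : ℝ, 0 < h → ∀ (w : L2) (K : Finset (Fin 2 → ℤ))
        (c : (Fin 2 → ℤ) → ℂ), ‖∑ k ∈ K, c k * ∫ x, r s (x, h • freq k) * mFourier (-k) x * w x
          ∂torusMeasure‖ ≤ M * (‖w‖ * √(∑ k ∈ K, ‖c k‖ ^ 2))) (s : ℝ) (hs : |s| ≤ |T|) :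
      ‖pairing h ε ψ r K (uε (s * (h / ε))) s‖ ≤ M * ‖ψ‖ ^ 2 := by
    rw [pairing_eq]
    refine (hM s hs h hh _ K _).trans ?_
    rw [hu.norm_eq hW hh, pow_two]
    gcongr
    refine le_trans (le_of_eq ?_) (sum_norm_sq_mFourierCoeff_le ψ K)
    congr 1
    refine Finset.sum_congr rfl fun k _ => ?_
    rw [norm_mul, RCLike.norm_conj, mul_comm I, norm_exp_ofReal_mul_I, mul_one]
  have hbound (s : ℝ) (hs : s ∈ Metric.closedBall (0 : ℝ) |T|) :
      ‖pairing h ε ψ (residual V (h / ε) h α) K (uε (s * (h / ε))) s‖ ≤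
      max M₁ M₂ * (‖l₁‖ + ‖l₂‖) * ‖ψ‖ ^ 2 := by
    have hs' : |s| ≤ |T| := by simpa using hs
    rw [hsplit]
    refine (norm_add_le _ _).trans ?_
    rw [norm_mul, norm_mul]
    have h1 := (hbd hM₁0 hM₁ s hs').trans
      (mul_le_mul_of_nonneg_right (le_max_left M₁ M₂) (sq_nonneg _))
    have h2 := (hbd hM₂0 hM₂ s hs').trans
      (mul_le_mul_of_nonneg_right (le_max_right M₁ M₂) (sq_nonneg _))
    have h3 := mul_le_mul_of_nonneg_left h1 (norm_nonneg l₁)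
    have h4 := mul_le_mul_of_nonneg_left h2 (norm_nonneg l₂)
    linarith
  have := (convex_closedBall (0 : ℝ) |T|).norm_image_sub_le_of_norm_hasDerivWithin_le
    (fun s _ => (hd s).hasDerivWithinAt) hbound (x := 0) (y := T) (by simp) (by simp)
  simp only [zero_mul, hu.initial, sub_zero, Real.norm_eq_abs] at this
  linarith

/-- At the initial time the pairing is a Wigner distribution. -/
theorem pairing_zero {α : ℝ → Phase → ℂ} (hα : IsSymbolFamily α) (hh : 0 < h) (ε : ℝ) (ψ : L2)
    (K : Finset (Fin 2 → ℤ)) (hK : ∀ k ∉ K, ∀ x, α 0 (x, h • freq k) = 0) :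
    pairing h ε ψ α K ψ 0 =
      starRingEnd ℂ (wigner h ψ fun p => starRingEnd ℂ (α 0 p)) := by
  rw [wigner_eq (hα.conj.isTestSymbol 0) hh ψ K (fun k hk x => by rw [hK k hk x, map_zero]),
    ← integral_conj, pairing_eq]
  simp only [← integral_const_mul]
  rw [← integral_finsetSum]
  · congr 1
    ext x
    simp only [map_mul, map_sum, Complex.conj_conj, Finset.mul_sum, mul_zero, ofReal_zero, exp_zero,
      mFourier_neg]
    refine Finset.sum_congr rfl fun k _ => ?_
    ring
  · intro k _
    exact (integrable_continuous_mul ((hα.torusSmooth 0 _).continuous.mul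
        (mFourier (-k)).continuous) ψ).const_mul _

/-- At the final time `T`, where the symbol is the cutoff, the pairing is the truncated overlap. -/
theorem norm_inner_sub_pairing_le {α : ℝ → Phase → ℂ}
    (hu : IsSchrodingerSolution h (fun _ => 0) ψ u) (hh : 0 < h) (ε R T : ℝ)
    (hαT : ∀ p, α T p = cutoff R p.2) (K : Finset (Fin 2 → ℤ))
    (hK : ∀ k ∉ K, cutoff R (h • freq k) = 0) (w : L2) :
    ‖⟪u (T * (h / ε)), w⟫_ℂ - pairing h ε ψ α K w T‖ ≤ ‖spectralProj h (Set.Ici R) ψ‖ * ‖w‖ := by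
  convert norm_inner_free_sub_le hu hh R (T * (h / ε)) K hK w using 3
  rw [pairing_eq]
  refine Finset.sum_congr rfl fun k _ => ?_
  have e : h / ε * h * ‖freq k‖ ^ 2 / 2 * T = h * ‖freq k‖ ^ 2 / 2 * (T * (h / ε)) := by ring
  have e' : ∫ x, α T (x, h • freq k) * mFourier (-k) x * w x ∂torusMeasure =
      cutoff R (h • freq k) * mFourierCoeff w k := by
    rw [mFourierCoeff_eq, ← integral_const_mul]
    simp only [hαT, mul_assoc]
  rw [e, e']
  ring

end

/-! ### Transported symbols and the semiclassical limit -/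

section

/-- Integrals over `[0, 1]` depend smoothly on parameters, being convolutions of an indicator function
with a smooth function. -/
theorem contDiff_integral_zero_one {P : Type*} [NormedAddCommGroup P] [NormedSpace ℝ P]
    {g : P × ℝ → ℝ} (hg : ContDiff ℝ ∞ g) : ContDiff ℝ ∞ fun p => ∫ t in (0 : ℝ)..1, g (p, t) := by
  let β : ContDiffBump (0 : ℝ) := ⟨1, 2, one_pos, one_lt_two⟩
  set f : ℝ → ℝ := (Set.Ioc (0 : ℝ) 1).indicator fun _ => 1 with hf
  have hfi : LocallyIntegrable f := by
    refine Integrable.locallyIntegrable ((integrable_indicator_iff measurableSet_Ioc).2 ?_)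
    exact integrableOn_const (by simp)
  have h := contDiffOn_convolution_right_with_param_comp (𝕜 := ℝ) (n := ⊤) (μ := volume)
    (ContinuousLinearMap.mul ℝ ℝ) (s := (Set.univ : Set P)) (v := fun _ => (0 : ℝ)) (f := f)
    (g := fun p s => g (p, -s) * β s) (k := Metric.closedBall 0 2) contDiffOn_const isOpen_univ
    (isCompact_closedBall _ _) (fun p x _ hx => by
      rw [β.zero_of_le_dist, mul_zero]
      simpa [β] using (not_le.1 (by simpa using hx)).le) hfi (by
      refine ContDiff.contDiffOn ?_
      exact (hg.comp (contDiff_fst.prodMk contDiff_snd.neg)).mul (β.contDiff.comp contDiff_snd))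
  convert! contDiffOn_univ.1 h using 2 with p
  rw [intervalIntegral.integral_of_le zero_le_one, ← integral_indicator measurableSet_Ioc,
    convolution_def]
  refine integral_congr_ae (.of_forall fun t => ?_)
  simp only [zero_sub, neg_neg, ContinuousLinearMap.mul_apply', hf, Set.indicator_apply]
  split_ifs with ht
  · rw [β.one_of_mem_closedBall, mul_one, one_mul]
    rw [Metric.mem_closedBall, dist_zero_right, norm_neg, Real.norm_eq_abs, abs_of_pos ht.1]
    exact ht.2
  · rw [zero_mul]

/-- The action of the potential along the geodesic flow. -/
noncomputable def flowIntegral (V : Torus → ℝ) (σ : ℝ) (p : Phase) : ℝ :=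
  ∫ s in (0 : ℝ)..σ, V (geodesicFlow s p).1

variable {V : Torus → ℝ}

theorem contDiff_flowIntegral (hV : TorusSmooth V) : ContDiff ℝ ∞
    fun p : ℝ × Plane × Plane => flowIntegral V p.1 (toTorus p.2.1, p.2.2) := by
  have e (p : ℝ × Plane × Plane) : flowIntegral V p.1 (toTorus p.2.1, p.2.2) =
      p.1 * ∫ t in (0 : ℝ)..1, V (toTorus (p.2.1 + (p.1 * t) • p.2.2)) := by
    have := intervalIntegral.smul_integral_comp_mul_left (a := 0) (b := 1)
      (fun t => V (toTorus (p.2.1 + t • p.2.2))) p.1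
    rw [smul_eq_mul, mul_zero, mul_one] at this
    rw [this, flowIntegral]
    simp only [geodesicFlow, toTorus_add]
  simp only [e]
  have hV' : ContDiff ℝ ∞ fun y : Plane => V (toTorus y) := hV
  refine contDiff_fst.mul (contDiff_integral_zero_one
    (g := fun q : (ℝ × Plane × Plane) × ℝ => V (toTorus (q.1.2.1 + (q.1.1 * q.2) • q.1.2.2))) ?_)
  refine hV'.comp (g := fun y : Plane => V (toTorus y)) ?_
  fun_prop

theorem continuous_flowIntegral (hV : TorusSmooth V) (σ : ℝ) : Continuous (flowIntegral V σ) := by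
  have := hV.continuous
  refine intervalIntegral.continuous_parametric_intervalIntegral_of_continuous' ?_ _ _
  simp only [Function.uncurry_def, geodesicFlow]
  fun_prop

theorem contDiff_cexp_mul_cutoff {E : Type*} [NormedAddCommGroup E] [NormedSpace ℝ E] {f : E → ℝ}
    (hf : ContDiff ℝ ∞ f) (R : ℝ) {g : E → Plane} (hg : ContDiff ℝ ∞ g) :
    ContDiff ℝ ∞ fun p => exp (-(I * (f p : ℝ))) * (cutoff R (g p) : ℝ) :=
  ((contDiff_const.mul (Complex.ofRealCLM.contDiff.comp hf)).neg.cexp).mul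
    (Complex.ofRealCLM.contDiff.comp ((contDiff_cutoff R).comp hg))

theorem exists_support_cutoff (R : ℝ) : ∃ R' : ℝ, ∀ ξ : Plane, R' < ‖ξ‖ → cutoff R ξ = 0 := by
  refine ⟨|R| + 1, fun ξ hξ => cutoff_eq_zero ?_⟩
  nlinarith [le_abs_self R, abs_nonneg R]

/-- The solution of the transport equation along the geodesic flow which equals the cutoff at time
`T`. -/
noncomputable def transportedSymbol (V : Torus → ℝ) (T R : ℝ) (s : ℝ) (p : Phase) : ℂ :=
  exp (-(I * (flowIntegral V (T - s) p : ℝ))) * cutoff R p.2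

theorem isSymbolFamily_transportedSymbol (hV : TorusSmooth V) (T R : ℝ) :
    IsSymbolFamily (transportedSymbol V T R) := by
  constructor
  · refine contDiff_cexp_mul_cutoff
      (f := fun p : ℝ × Plane × Plane => flowIntegral V (T - p.1) (toTorus p.2.1, p.2.2)) ?_ R
      contDiff_snd.snd
    exact (contDiff_flowIntegral hV).comp ((contDiff_const.sub contDiff_fst).prodMk contDiff_snd)
  · obtain ⟨R', hR'⟩ := exists_support_cutoff R
    exact ⟨R', fun s p hp => by rw [transportedSymbol, hR' _ hp, ofReal_zero, mul_zero]⟩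

/-- The transported symbol solves `∂_s α + ξ · ∇α = i V α`, as one sees by differentiating it along the
line `s ↦ (s, x + s ξ, ξ)`; the Laplacian is all that remains of the residual. -/
theorem residual_transportedSymbol (hV : TorusSmooth V) (T R h s : ℝ) (p : Phase) :
    residual V 1 h (transportedSymbol V T R) s p = I * (h / 2 : ℝ) *
      torusLaplacian (fun q => transportedSymbol V T R s (q, p.2)) p.1 := by
  obtain ⟨q, ξ⟩ := p
  obtain ⟨x, rfl⟩ := isOpenQuotientMap_toTorus.surjective q
  have hα := isSymbolFamily_transportedSymbol hV T R
  set A := fun p : ℝ × Plane × Plane => transportedSymbol V T R p.1 (toTorus p.2.1, p.2.2) with hA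
  have h1 : deriv (fun s => transportedSymbol V T R s (toTorus x, ξ)) s =
      dirDeriv ((1 : ℝ), (0 : Plane), (0 : Plane)) A (s, x, ξ) := by
    have := hasDerivAt_line hα.smooth ((0 : ℝ), x, ξ) ((1 : ℝ), (0 : Plane), (0 : Plane)) s
    simp only [Prod.smul_mk, Prod.mk_add_mk, smul_zero, add_zero, zero_add, smul_eq_mul,
      mul_one] at this
    exact this.deriv
  have h2 := hα.torusDeriv_eq s x ξ ξ
  have h3 : dirDeriv ((1 : ℝ), ξ, (0 : Plane)) A (s, x, ξ) =
      I * V (toTorus x) * transportedSymbol V T R s (toTorus x, ξ) := by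
    have := hasDerivAt_line hα.smooth (s, x, ξ) ((1 : ℝ), ξ, (0 : Plane)) 0
    simp only [Prod.smul_mk, Prod.mk_add_mk, smul_zero, add_zero, smul_eq_mul,
      mul_one, zero_smul] at this
    refine this.unique ?_
    have hc : Continuous fun r : ℝ => V (toTorus x + toTorus (r • ξ)) := by
      have := hV.continuous
      fun_prop
    have e (t : ℝ) : flowIntegral V (T - (s + t)) (toTorus (x + t • ξ), ξ) =
        ∫ r in t..(T - s), V (toTorus x + toTorus (r • ξ)) := by
      have := intervalIntegral.integral_comp_add_right (a := 0) (b := T - (s + t))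
        (fun r => V (toTorus x + toTorus (r • ξ))) t
      rw [zero_add, show T - (s + t) + t = T - s by ring] at this
      rw [← this, flowIntegral]
      congr 1
      ext r
      simp only [geodesicFlow, add_smul, toTorus_add]
      rw [add_assoc, add_comm (toTorus (t • ξ))]
    have e0 : flowIntegral V (T - s) (toTorus x, ξ) =
        ∫ r in (0 : ℝ)..(T - s), V (toTorus x + toTorus (r • ξ)) := by
      simpa using e 0
    simp only [transportedSymbol, e, e0]
    have hd := intervalIntegral.integral_hasDerivAt_left (a := (0 : ℝ)) (b := T - s)
      (hc.intervalIntegrable _ _) (hc.stronglyMeasurableAtFilter _ _) hc.continuousAt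
    rw [zero_smul, toTorus_zero, add_zero] at hd
    convert! ((hd.ofReal_comp.const_mul I).neg.cexp).mul_const (cutoff R ξ : ℂ) using 1
    simp only [Pi.neg_apply]
    push_cast
    ring
  have h4 : dirDeriv ((1 : ℝ), ξ, (0 : Plane)) A (s, x, ξ) =
      dirDeriv ((1 : ℝ), (0 : Plane), (0 : Plane)) A (s, x, ξ) +
      dirDeriv ((0 : ℝ), ξ, (0 : Plane)) A (s, x, ξ) := by
    simp only [dirDeriv, ← map_add]
    simp
  rw [residual]
  simp only [h1, h2]
  rw [← hA, ofReal_one, one_mul, ← h4, h3]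
  ring_nf

/-- The solution of `∂_s α = i V α` which equals the cutoff at time `T`: when the time scale `τ` is
short, the transport term `τ ξ · ∇α` is negligible and the potential may be frozen. -/
noncomputable def frozenSymbol (V : Torus → ℝ) (T R : ℝ) (s : ℝ) (p : Phase) : ℂ :=
  exp (-(I * ((T - s) * V p.1 : ℝ))) * cutoff R p.2

theorem isSymbolFamily_frozenSymbol (hV : TorusSmooth V) (T R : ℝ) :
    IsSymbolFamily (frozenSymbol V T R) := by
  have hV' : ContDiff ℝ ∞ fun y : Plane => V (toTorus y) := hV
  constructor
  · exact contDiff_cexp_mul_cutoff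
      (f := fun p : ℝ × Plane × Plane => (T - p.1) * V (toTorus p.2.1))
      ((contDiff_const.sub contDiff_fst).mul (hV'.comp contDiff_snd.fst)) R contDiff_snd.snd
  · obtain ⟨R', hR'⟩ := exists_support_cutoff R
    exact ⟨R', fun s p hp => by rw [frozenSymbol, hR' _ hp, ofReal_zero, mul_zero]⟩

theorem residual_frozenSymbol (V : Torus → ℝ) (T R τ h s : ℝ) (p : Phase) :
    residual V τ h (frozenSymbol V T R) s p =
      τ * torusDeriv (fun q => frozenSymbol V T R s (q, p.2)) p.1 p.2 +
      I * (τ * h / 2 : ℝ) * torusLaplacian (fun q => frozenSymbol V T R s (q, p.2)) p.1 := by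
  have h1 : HasDerivAt (fun s : ℝ => (T - s) * V p.1) (-1 * V p.1) s :=
    ((hasDerivAt_id s).const_sub T).mul_const _
  have h2 : HasDerivAt (fun s => frozenSymbol V T R s p) (I * V p.1 * frozenSymbol V T R s p) s := by
    convert! ((h1.ofReal_comp.const_mul I).neg.cexp).mul_const (cutoff R p.2 : ℂ) using 1
    rw [frozenSymbol]
    simp only [Pi.neg_apply]
    push_cast
    ring
  rw [residual, h2.deriv]
  ring

/-- The overlap converges as soon as, for each cutoff, there is a family of symbols with vanishing
residual which interpolates between the cutoff at time `T` and the truncation of `conj b` at time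
`0`. -/
theorem tendsto_overlap (hV : TorusSmooth V) {H : Set ℝ} (hH : H ⊆ Set.Ioc 0 1) {ε : ℝ → ℝ}
    (hε : ∀ h ∈ H, 0 < ε h) {ψ : ℝ → L2} (hψ : ∀ h ∈ H, ‖ψ h‖ = 1)
    (hosc : IsOscillating H ψ) {F₀ : Measure Phase} (hF₀ : IsSemiclassicalMeasure H ψ F₀)
    {u uε : ℝ → ℝ → L2} (hu : ∀ h ∈ H, IsSchrodingerSolution h (fun _ => 0) (ψ h) (u h))
    (huε : ∀ h ∈ H, IsSchrodingerSolution h (fun x => ε h * V x) (ψ h) (uε h)) (T : ℝ)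
    {b : Phase → ℂ} (hb : Continuous b) (hb1 : ∀ p, ‖b p‖ ≤ 1) {α r₁ r₂ : ℝ → ℝ → Phase → ℂ}
    (hα : ∀ R, IsSymbolFamily (α R)) (hr₁ : ∀ R, IsSymbolFamily (r₁ R))
    (hr₂ : ∀ R, IsSymbolFamily (r₂ R)) (hαT : ∀ R p, α R T p = cutoff R p.2)
    (hα0 : ∀ R p, starRingEnd ℂ (α R 0 p) = b p * cutoff R p.2) {l₁ l₂ : ℝ → ℂ}
    (hl₁ : Tendsto l₁ (𝓝[H] 0) (𝓝 0)) (hl₂ : Tendsto l₂ (𝓝[H] 0) (𝓝 0))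
    (hres : ∀ R, ∀ h ∈ H, ∀ s p,
      residual V (h / ε h) h (α R) s p = l₁ h * r₁ R s p + l₂ h * r₂ R s p) :
    Tendsto (fun h => ‖inner ℂ (uε h (T * (h / ε h))) (u h (T * (h / ε h)))‖ ^ 2) (𝓝[H] 0)
      (𝓝 (‖∫ p, b p ∂F₀‖ ^ 2)) := by
  obtain ⟨hfin, hF⟩ := hF₀
  suffices hmain : Tendsto (fun h => ⟪u h (T * (h / ε h)), uε h (T * (h / ε h))⟫_ℂ) (𝓝[H] 0)
      (𝓝 (starRingEnd ℂ (∫ p, b p ∂F₀))) by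
    have := hmain.norm.pow 2
    rw [RCLike.norm_conj] at this
    exact this.congr fun h => by rw [norm_inner_symm]
  have hcut : Tendsto (fun R => ∫ p, b p * cutoff R p.2 ∂F₀) atTop (𝓝 (∫ p, b p ∂F₀)) := by
    refine tendsto_integral_filter_of_dominated_convergence (fun _ => 1) (.of_forall fun R => ?_)
      (.of_forall fun R => .of_forall fun p => ?_) (integrable_const _) (.of_forall fun p => ?_)
    · have := (contDiff_cutoff R).continuous
      exact Continuous.aestronglyMeasurable (by fun_prop)
    · rw [norm_mul, Complex.norm_real, Real.norm_eq_abs, abs_of_nonneg (cutoff_nonneg _ _)]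
      exact mul_le_one₀ (hb1 p) (cutoff_nonneg _ _) (cutoff_le_one _ _)
    · refine tendsto_const_nhds.congr' ?_
      filter_upwards [eventually_ge_atTop (‖p.2‖ ^ 2)] with R hR
      rw [cutoff_eq_one hR, ofReal_one, mul_one]
  rw [Metric.tendsto_nhds]
  intro δ hδ
  have hδ4 : 0 < δ / 4 := by positivity
  -- The cutoff is fixed before the semiclassical limit is taken.
  obtain ⟨R, hR1, hR2⟩ := ((hosc.eventually (gt_mem_nhds hδ4)).and
    (Metric.tendsto_nhds.1 hcut (δ / 4) hδ4)).exists
  have hspec : ∀ᶠ h in 𝓝[H] 0, ‖spectralProj h (Set.Ici R) (ψ h)‖ < δ / 4 := by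
    refine eventually_lt_of_limsup_lt hR1 ⟨1, ?_⟩
    rw [eventually_map]
    filter_upwards [self_mem_nhdsWithin] with h hh
    exact (norm_spectralProj_le h _ (ψ h)).trans_eq (hψ h hh)
  obtain ⟨M, hM⟩ := norm_pairing_sub_le (hα R) (hr₁ R) (hr₂ R) hV T
  have hsmall : ∀ᶠ h in 𝓝[H] 0, M * (‖l₁ h‖ + ‖l₂ h‖) < δ / 4 := by
    have := (hl₁.norm.add hl₂.norm).const_mul M
    rw [norm_zero, add_zero, mul_zero] at this
    exact this.eventually (gt_mem_nhds hδ4)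
  have hw := Metric.tendsto_nhds.1 (hF _ ((hα R).conj.isTestSymbol 0)) (δ / 4) hδ4
  simp only [hα0] at hw
  filter_upwards [self_mem_nhdsWithin, hspec, hsmall, hw] with h hhH h1 h2 h3
  have hh : 0 < h := (hH hhH).1
  set K := (finite_freq hh R).toFinset with hK
  have hKc (k : Fin 2 → ℤ) (hk : k ∉ K) : cutoff R (h • freq k) = 0 :=
    cutoff_eq_zero (by simpa [hK] using hk)
  have hK0 (k : Fin 2 → ℤ) (hk : k ∉ K) (x : Torus) : α R 0 (x, h • freq k) = 0 := by
    rw [← Complex.conj_conj (α R 0 _), hα0]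
    simp [hKc k hk]
  set w := uε h (T * (h / ε h)) with hwdef
  have hwn : ‖w‖ = 1 := by
    rw [hwdef, (huε h hhH).norm_eq (continuous_const.mul hV.continuous) hh, hψ h hhH]
  have s1 := norm_inner_sub_pairing_le (hu h hhH) hh (ε h) R T (hαT R) K hKc w
  have s2 := hM h (ε h) (l₁ h) (l₂ h) (ψ h) (uε h) (huε h hhH) hh (hε h hhH) (hres R h hhH) K
  have s3 := pairing_zero (hα R) hh (ε h) (ψ h) K hK0
  rw [hwn, mul_one] at s1
  rw [hψ h hhH, one_pow, mul_one, s3, ← hwdef] at s2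
  simp only [hα0] at s2
  set I₁ := ⟪u h (T * (h / ε h)), w⟫_ℂ
  set I₂ := pairing h (ε h) (ψ h) (α R) K w T
  set I₃ := wigner h (ψ h) fun p => b p * cutoff R p.2
  set I₄ := ∫ p, b p * cutoff R p.2 ∂F₀
  set I₅ := ∫ p, b p ∂F₀
  have e : I₁ - starRingEnd ℂ I₅ = (I₁ - I₂) + (I₂ - starRingEnd ℂ I₃) + starRingEnd ℂ (I₃ - I₄) +
      starRingEnd ℂ (I₄ - I₅) := by
    simp only [map_sub]; ring
  rw [dist_eq_norm] at h3 hR2 ⊢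
  rw [e]
  refine (norm_add₄_le).trans_lt ?_
  rw [RCLike.norm_conj, RCLike.norm_conj]
  linarith

end

end Loschmidt

open Loschmidt
theorem theoremt
    (V : Torus → ℝ) (hV : TorusSmooth V)
    (H : Set ℝ) (hH : H ⊆ Set.Ioc 0 1)
    (ε : ℝ → ℝ) (hε : ∀ h ∈ H, 0 < ε h ∧ ε h ≤ 1)
    (ψ : ℝ → L2) (hψ : ∀ h ∈ H, ‖ψ h‖ = 1) (hosc : IsOscillating H ψ)
    (F₀ : Measure Phase) (hF₀ : IsSemiclassicalMeasure H ψ F₀)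
    (u uε : ℝ → ℝ → L2)
    (hu : ∀ h ∈ H, IsSchrodingerSolution h (fun _ => 0) (ψ h) (u h))
    (huε : ∀ h ∈ H, IsSchrodingerSolution h (fun x => ε h * V x) (ψ h) (uε h)) :
    ((∀ h ∈ H, ε h = h) → ∀ t : ℝ,
      Tendsto (fun h => ‖inner ℂ (uε h (t * (h / ε h))) (u h (t * (h / ε h)))‖ ^ 2) (𝓝[H] 0)
        (𝓝 (‖∫ p, exp (I * (∫ s in (0 : ℝ)..t, V (geodesicFlow s p).1 : ℝ)) ∂F₀‖ ^ 2))) ∧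
    (Tendsto (fun h => h / ε h) (𝓝[H] 0) (𝓝 0) → ∀ t : ℝ,
      Tendsto (fun h => ‖inner ℂ (uε h (t * (h / ε h))) (u h (t * (h / ε h)))‖ ^ 2) (𝓝[H] 0)
        (𝓝 (‖∫ p, exp (I * (t * V p.1 : ℝ)) ∂F₀‖ ^ 2))) := by
  have hid : Tendsto (fun h : ℝ => h) (𝓝[H] 0) (𝓝 0) := tendsto_id.mono_left nhdsWithin_le_nhds
  have hVc := hV.continuous
  have hε0 : ∀ h ∈ H, 0 < ε h := fun h hh => (hε h hh).1
  constructor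
  · intro hεh T
    have hflow := continuous_flowIntegral hV T
    refine tendsto_overlap hV hH hε0 hψ hosc hF₀ hu huε T
      (b := fun p => exp (I * (flowIntegral V T p : ℝ))) (by fun_prop)
      (fun p => by rw [mul_comm, norm_exp_ofReal_mul_I])
      (α := transportedSymbol V T) (isSymbolFamily_transportedSymbol hV T)
      (fun R => (isSymbolFamily_transportedSymbol hV T R).laplacian)
      (fun R => (isSymbolFamily_transportedSymbol hV T R).laplacian)
      (fun R p => ?_) (fun R p => ?_) (l₁ := fun h => I * (h / 2 : ℝ)) (l₂ := fun _ => 0) ?_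
      tendsto_const_nhds (fun R h hh s p => ?_)
    · simp [transportedSymbol, flowIntegral]
    · simp only [transportedSymbol, map_mul, ← exp_conj, map_neg, conj_ofReal, conj_I, sub_zero]
      rw [neg_mul, neg_neg]
    · have := (continuous_ofReal.tendsto (0 : ℝ)).comp hid
      simpa using (this.div_const 2).const_mul I
    · rw [hεh h hh, div_self (hH hh).1.ne', residual_transportedSymbol hV, zero_mul, add_zero]
  · intro hτ T
    have hfr := isSymbolFamily_frozenSymbol hV T
    refine tendsto_overlap hV hH hε0 hψ hosc hF₀ hu huε T
      (b := fun p => exp (I * (T * V p.1 : ℝ))) (by fun_prop)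
      (fun p => by rw [mul_comm, norm_exp_ofReal_mul_I])
      (α := frozenSymbol V T) hfr (fun R => (hfr R).deriv_self) (fun R => (hfr R).laplacian)
      (fun R p => ?_) (fun R p => ?_) (l₁ := fun h => (h / ε h : ℝ))
      (l₂ := fun h => I * (h / ε h * h / 2 : ℝ)) ?_ ?_
      (fun R h _ s p => residual_frozenSymbol V T R (h / ε h) h s p)
    · simp [frozenSymbol]
    · simp only [frozenSymbol, map_mul, ← exp_conj, map_neg, conj_ofReal, conj_I, sub_zero]
      rw [neg_mul, neg_neg]
    · exact (continuous_ofReal.tendsto' (0 : ℝ) 0 ofReal_zero).comp hτ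
    · have h1 : Tendsto (fun h => h / ε h * h / 2) (𝓝[H] 0) (𝓝 0) := by
        simpa using (hτ.mul hid).div_const 2
      have h2 := (continuous_ofReal.tendsto' (0 : ℝ) 0 ofReal_zero).comp h1
      simpa using h2.const_mul I
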